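/- Let $\mathbb{T}=\mathbb{R}/2\pi\mathbb{Z}$ and let $v:\mathbb{T}\to\mathbb{R}$ be of class $C^2$ with only finitely many critical points, all of them simple, i.e. $v''(y)\neq 0$ whenever $v'(y)=0$. Then there are constants $\nu_0,\,C_\xi,\,C_\xi',\,C_{\rm ed}>0$, depending only on $v$, such that for all $0<\nu\le\nu_0$ and all integers $k\neq 0$ one has $C_\xi'\ge \nu/|k|$ and the following holds. Let $T>0$ be arbitrary (finite), and let $\xi$ be absolutely continuous on $[0,T]$ with $$0\le \xi(t)\le 1 \ \text{ for all } t\in[0,T],\qquad \xi'(t)\le C_\xi(\nu|k|)^{1/2}\ \text{ for a.e. } t\in[0,T]$$ (no positive lower bound on $\xi$ is required, so the flow may be switched on and off). Let $\hat\Theta_0\in L^2(\mathbb{T};\mathbb{C})$ and let $\hat\Theta\in C([0,T];L^2(\mathbb{T};\mathbb{C}))$ be a weak solution of $$\partial_t\hat\Theta+ik\,\xi(t)v(y)\hat\Theta=\nu(-k^2+\partial_y^2)\hat\Theta,\qquad \hat\Theta(0)=\hat\Theta_0,$$ meaning that for every smooth $\varphi:\mathbb{T}\to\mathbb{C}$ and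 every $t\in[0,T]$ $$\int_{\mathbb{T}}\hat\Theta(t)\varphi\,dy=\int_{\mathbb{T}}\hat\Theta_0\varphi\,dy+\int_0^t\int_{\mathbb{T}}\hat\Theta(s)\bigl[\nu(-k^2\varphi+\varphi'')-ik\,\xi(s)v\varphi\bigr]dy\,ds .$$ Then for all $t\in[0,T]$ $$\|\hat\Theta(t)\|_{L^2(\mathbb{T})}^2\le C_{\rm ed}\Bigl(1+\bigl(\tfrac{|k|}{\nu}\bigr)^{1/2}\Bigr)\exp\Bigl(-C_\xi'(\nu|k|)^{1/2}\int_0^t\xi(\tau)^3\,d\tau-2\nu k^2t\Bigr)\|\hat\Theta_0\|_{L^2(\mathbb{T})}^2 .$$ -/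

import Mathlib

open Real Set MeasureTheory
open scoped ContDiff ENNReal

namespace ShearFlow

instance instFactTwoPiPos : Fact (0 < 2 * π) := ⟨Real.two_pi_pos⟩

/-- The circle `𝕋 = ℝ / 2πℤ`. -/
abbrev Circ : Type := AddCircle (2 * π)

/-- The space `L²(𝕋)` of complex functions. The Haar measure is normalised to total mass one,
that is, it is `dy / 2π`; all relations below are homogeneous in the measure, so this
normalisation is immaterial. -/
abbrev L2Circ : Type := Lp ℂ 2 (AddCircle.haarAddCircle : Measure Circ)

/-- A function on the circle is of class `C^n` if its `2π`-periodic lift to `ℝ` is. -/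
def IsCn {E : Type*} [NormedAddCommGroup E] [NormedSpace ℝ E] (n : WithTop ℕ∞)
    (f : Circ → E) : Prop :=
  ContDiff ℝ n (fun y : ℝ => f (y : Circ))

/-- The derivative `∂_y f` of a function on the circle. -/
noncomputable def dy {E : Type*} [NormedAddCommGroup E] [NormedSpace ℝ E]
    (f : Circ → E) (x : Circ) : E :=
  deriv (fun s : ℝ => f (x + (s : Circ))) 0

/-- `v` has only finitely many critical points, and all of them are simple: `v'' ≠ 0` there. -/
def HasSimpleCriticalPoints (v : Circ → ℝ) : Prop :=
  {y : Circ | dy v y = 0}.Finite ∧ ∀ y : Circ, dy v y = 0 → dy (dy v) y ≠ 0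

/-- `Θ` is a weak solution on `[0, T]`, continuous in time with values in `L²(𝕋)`, of
`∂ₜ Θ + i k ξ(t) v(y) Θ = ν (-k² + ∂_y²) Θ` with initial value `Θ₀`: the equation is tested with
smooth functions `φ` on the circle and integrated in time. -/
structure IsWeakSolution (ν : ℝ) (k : ℤ) (ξ : ℝ → ℝ) (v : Circ → ℝ) (T : ℝ)
    (Θ₀ : L2Circ) (Θ : ℝ → L2Circ) : Prop where
  continuousOn : ContinuousOn Θ (Icc 0 T)
  initial : Θ 0 = Θ₀
  weak : ∀ φ : Circ → ℂ, IsCn ∞ φ → ∀ t ∈ Icc 0 T,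
    ∫ y, Θ t y * φ y ∂AddCircle.haarAddCircle =
      (∫ y, Θ₀ y * φ y ∂AddCircle.haarAddCircle) +
      ∫ s in (0 : ℝ)..t, ∫ y, Θ s y *
        ((ν : ℂ) * (-(k : ℂ) ^ 2 * φ y + dy (dy φ) y)
          - Complex.I * (k : ℂ) * (ξ s : ℂ) * (v y : ℂ) * φ y) ∂AddCircle.haarAddCircle

end ShearFlow

/-! The proof is a hypocoercivity argument whose corrector remembers the past of `ξ`. Put f =
exp(νk²t) Θ, which removes the damping νk², so that ∂ₜf = ν∂²f − ikξ v f. The transport term is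
skew, so the energy identity only gives d/dt ‖f‖² = −2ν‖∂f‖². Extra decay must come from the mixing
term −ikξ v' f in the equation for ∂f.

Let κ = a(ν|k|)^{1/2} with a large, let Y solve Y' = ξ − κY, and set g = ∂f + ikY v' f.
Differentiating ikY v' f produces +ikξ v' f, which cancels the large forcing of ∂f. What remains is
−ikκY v' f = −κ(g − ∂f), a damping of g, together with commutators of size ν|k|Y that are small
because κ² = A ν|k| with A = a² large. One of them is kept in divergence form, so that v'' suffices
and v''' never appears. Hence the functional ‖f‖² + (ν/κ)‖g‖² loses about ν(‖∂f‖² + ‖g‖²) per unit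
time.

Since ikY v' f = g − ∂f, this loss controls νk²Y²‖v' f‖². Simplicity of the critical points gives
the spectral gap c₀ε‖f‖² ≤ ε²‖∂f‖² + ‖v' f‖² (`IsDerivPair.exists_spectral_gap`). With ε = κ/|k| the
functional decays at rate c₁νκ|k|Y² (`IsShear.lyapunov`).

The bound ξ' ≤ κ/2 prevents a sudden rise of `ξ`, which gives ξ² ≤ 6κY and then ∫ξ³ ≤ 6κ²∫Y²
(`exists_memory`). This turns the rate into a multiple of (ν|k|)^{1/2} ∫ξ³, with no lower bound on
`ξ`. The initial datum is only in L², so the functional is started at a time t₁ ≤ 1/κ at which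
parabolic smoothing bounds ∂f; starting g there costs the factor 1 + (|k|/ν)^{1/2}
(`IsShear.decay`).

All energy computations are made on Fourier coefficients, which satisfy ordinary differential
equations, and are then summed. No regularity of the weak solution is presupposed. -/

namespace ShearFlow

open scoped InnerProductSpace ComplexConjugate

/-! ### Parseval identities and differentiation by coefficients. -/

section HilbertBasisCalculus

variable {H : Type*} [NormedAddCommGroup H] [InnerProductSpace ℂ H] (b : HilbertBasis ℤ ℂ H)

theorem hasSum_sq_norm_inner (x : H) : HasSum (fun n => ‖⟪b n, x⟫_ℂ‖ ^ 2) (‖x‖ ^ 2) := by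
  have h := b.hasSum_inner_mul_inner x x
  rw [inner_self_eq_norm_sq_to_K] at h
  have h2 : ∀ n, ⟪x, b n⟫_ℂ * ⟪b n, x⟫_ℂ = ((‖⟪b n, x⟫_ℂ‖ ^ 2 : ℝ) : ℂ) := fun n => by
    rw [← inner_conj_symm x (b n), mul_comm, Complex.mul_conj, Complex.normSq_eq_norm_sq]
  simp only [h2] at h
  have h3 : ((‖x‖ : ℂ)) ^ 2 = ((‖x‖ ^ 2 : ℝ) : ℂ) := by push_cast; rfl
  exact Complex.hasSum_ofReal.1 (h3 ▸ h)

theorem norm_inner_mul_inner_le (x y : H) (n : ℤ) :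
    ‖⟪x, b n⟫_ℂ * ⟪b n, y⟫_ℂ‖ ≤ (‖⟪b n, x⟫_ℂ‖ ^ 2 + ‖⟪b n, y⟫_ℂ‖ ^ 2) / 2 := by
  rw [norm_mul, norm_inner_symm x (b n)]
  nlinarith [sq_nonneg (‖⟪b n, x⟫_ℂ‖ - ‖⟪b n, y⟫_ℂ‖)]

theorem hasSum_integral_inner {x y : ℝ → H} {s t : ℝ} (hst : s ≤ t)
    (hx : ContinuousOn x (Icc s t)) (hy : ContinuousOn y (Icc s t)) :
    HasSum (fun n => ∫ τ in s..t, ⟪x τ, b n⟫_ℂ * ⟪b n, y τ⟫_ℂ) (∫ τ in s..t, ⟪x τ, y τ⟫_ℂ) := by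
  have hsum : ∀ τ, HasSum (fun n => (‖⟪b n, x τ⟫_ℂ‖ ^ 2 + ‖⟪b n, y τ⟫_ℂ‖ ^ 2) / 2)
      ((‖x τ‖ ^ 2 + ‖y τ‖ ^ 2) / 2) := fun τ =>
    ((hasSum_sq_norm_inner b _).add (hasSum_sq_norm_inner b _)).div_const 2
  have hsub : uIoc s t ⊆ Icc s t := by rw [uIoc_of_le hst]; exact Ioc_subset_Icc_self
  refine intervalIntegral.hasSum_integral_of_dominated_convergence
    (fun n τ => (‖⟪b n, x τ⟫_ℂ‖ ^ 2 + ‖⟪b n, y τ⟫_ℂ‖ ^ 2) / 2) ?_ ?_ ?_ ?_ ?_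
  · intro n
    refine ContinuousOn.aestronglyMeasurable ?_ measurableSet_uIoc
    exact ((hx.inner continuousOn_const).mul (continuousOn_const.inner hy)).mono hsub
  · exact fun n => Filter.Eventually.of_forall fun τ _ => norm_inner_mul_inner_le b _ _ n
  · exact Filter.Eventually.of_forall fun τ _ => (hsum τ).summable
  · simp only [(hsum _).tsum_eq]
    refine ContinuousOn.intervalIntegrable ?_
    rw [uIcc_of_le hst]
    exact ((hx.norm.pow 2).add (hy.norm.pow 2)).div_const 2
  · exact Filter.Eventually.of_forall fun τ _ => b.hasSum_inner_mul_inner _ _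

theorem hasSum_integral_re_inner {x y : ℝ → H} {s t : ℝ} (hst : s ≤ t)
    (hx : ContinuousOn x (Icc s t)) (hy : ContinuousOn y (Icc s t)) :
    HasSum (fun n => ∫ τ in s..t, (⟪x τ, b n⟫_ℂ * ⟪b n, y τ⟫_ℂ).re)
      (∫ τ in s..t, (⟪x τ, y τ⟫_ℂ).re) := by
  have h := Complex.reCLM.hasSum (hasSum_integral_inner b hst hx hy)
  rw [← uIcc_of_le hst] at hx hy
  convert h using 1
  · funext n
    exact Complex.reCLM.intervalIntegral_comp_comm (ContinuousOn.intervalIntegrable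
      ((hx.inner continuousOn_const).mul (continuousOn_const.inner hy)))
  · exact Complex.reCLM.intervalIntegral_comp_comm (ContinuousOn.intervalIntegrable (hx.inner hy))

theorem hasSum_integral_sq {x : ℝ → H} {s t : ℝ} (hst : s ≤ t) (hx : ContinuousOn x (Icc s t)) :
    HasSum (fun n => ∫ τ in s..t, ‖⟪b n, x τ⟫_ℂ‖ ^ 2) (∫ τ in s..t, ‖x τ‖ ^ 2) := by
  have h := hasSum_integral_re_inner b hst hx hx
  convert h using 1
  · funext n
    congr 1; funext τ
    rw [← inner_conj_symm (x τ) (b n), mul_comm, Complex.mul_conj, Complex.normSq_eq_norm_sq,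
      Complex.ofReal_re]
  · congr 1; funext τ
    exact (inner_self_eq_norm_sq (𝕜 := ℂ) (x τ)).symm

/-- `h` is the derivative of `f` in the sense of coefficients: `h_n = i n f_n`. -/
def HasDer (f h : H) : Prop := ∀ n : ℤ, ⟪b n, h⟫_ℂ = Complex.I * n * ⟪b n, f⟫_ℂ

variable {b}

theorem HasDer.integration_by_parts {f h φ ψ : H} (hf : HasDer b f h) (hφ : HasDer b φ ψ) :
    ⟪ψ, f⟫_ℂ = -⟪φ, h⟫_ℂ := by
  have h1 := b.hasSum_inner_mul_inner ψ f
  have h2 := (b.hasSum_inner_mul_inner φ h).neg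
  refine h1.unique (h2.congr_fun ?_)
  intro n
  rw [← inner_conj_symm ψ, ← inner_conj_symm φ, hf n, hφ n]
  simp only [map_mul, Complex.conj_I, map_intCast]
  ring

theorem HasDer.sq_norm {f h : H} (hf : HasDer b f h) (n : ℤ) :
    ‖⟪b n, h⟫_ℂ‖ ^ 2 = (n : ℝ) ^ 2 * ‖⟪b n, f⟫_ℂ‖ ^ 2 := by
  rw [hf n, norm_mul, norm_mul, Complex.norm_I, one_mul, mul_pow]
  congr 1
  rw [Complex.norm_intCast, sq_abs]

theorem HasDer.sub {f h φ ψ : H} (hf : HasDer b f h) (hφ : HasDer b φ ψ) :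
    HasDer b (f - φ) (h - ψ) := fun n => by
  rw [inner_sub_right, inner_sub_right, hf n, hφ n]; ring

theorem hasDer_basis (n : ℤ) : HasDer b (b n) ((Complex.I * n) • b n) := fun m => by
  rw [inner_smul_right]
  rcases eq_or_ne m n with rfl | hmn
  · rfl
  · rw [b.orthonormal.2 hmn]; simp

variable (b)

open Classical in
/-- The derivative of `f`, where it exists. -/
noncomputable def der (f : H) : H :=
  if h : Memℓp (fun n : ℤ => Complex.I * n * ⟪b n, f⟫_ℂ) 2 then b.repr.symm ⟨_, h⟩ else 0

variable {b}

theorem hasDer_der {f : H} (hf : Summable fun n : ℤ => (n : ℝ) ^ 2 * ‖⟪b n, f⟫_ℂ‖ ^ 2) :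
    HasDer b f (der b f) := by
  have h : Memℓp (fun n : ℤ => Complex.I * n * ⟪b n, f⟫_ℂ) 2 := by
    refine memℓp_gen (hf.congr fun n => ?_)
    simp [mul_pow]
  intro n
  rw [der, dif_pos h, ← b.repr_apply_apply, LinearIsometryEquiv.apply_symm_apply]

end HilbertBasisCalculus

theorem HasDerivAt.sq_norm_complex {c : ℝ → ℂ} {c' : ℂ} {t : ℝ} (h : HasDerivAt c c' t) :
    HasDerivAt (fun t => ‖c t‖ ^ 2) (2 * (conj (c t) * c').re) t := by
  have := h.norm_sq
  rwa [Complex.inner, mul_comm c'] at this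

/-! ### Energy identities and parabolic smoothing for the forced heat equation, mode by mode. -/

section HeatFlow

variable {H : Type*} [NormedAddCommGroup H] [InnerProductSpace ℂ H] {b : HilbertBasis ℤ ℂ H}

theorem sq_norm_mode_sub {ν s t : ℝ} (hst : s ≤ t) {g F G : ℝ → H}
    (hg : ContinuousOn g (Icc s t)) (hF : ContinuousOn F (Icc s t)) (hG : ContinuousOn G (Icc s t))
    {n : ℤ} (hmode : ∀ τ ∈ Ioo s t, HasDerivAt (fun τ => ⟪b n, g τ⟫_ℂ)
      (-((ν * n ^ 2 : ℝ) : ℂ) * ⟪b n, g τ⟫_ℂ + Complex.I * n * ⟪b n, F τ⟫_ℂ + ⟪b n, G τ⟫_ℂ) τ) :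
    ‖⟪b n, g t⟫_ℂ‖ ^ 2 - ‖⟪b n, g s⟫_ℂ‖ ^ 2 = ∫ τ in s..t,
      (-(2 * ν) * (n ^ 2 * ‖⟪b n, g τ⟫_ℂ‖ ^ 2) +
        2 * (⟪g τ, b n⟫_ℂ * (Complex.I * n * ⟪b n, F τ⟫_ℂ)).re +
        2 * (⟪g τ, b n⟫_ℂ * ⟪b n, G τ⟫_ℂ).re) := by
  have hgn : ContinuousOn (fun τ => ⟪b n, g τ⟫_ℂ) (Icc s t) := continuousOn_const.inner hg
  have hgn' : ContinuousOn (fun τ => ⟪g τ, b n⟫_ℂ) (Icc s t) := hg.inner continuousOn_const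
  have hFn : ContinuousOn (fun τ => ⟪b n, F τ⟫_ℂ) (Icc s t) := continuousOn_const.inner hF
  have hGn : ContinuousOn (fun τ => ⟪b n, G τ⟫_ℂ) (Icc s t) := continuousOn_const.inner hG
  symm
  refine intervalIntegral.integral_eq_sub_of_hasDerivAt_of_le
    (f := fun τ => ‖⟪b n, g τ⟫_ℂ‖ ^ 2) hst (hgn.norm.pow 2) ?_ ?_
  · intro τ hτ
    refine (HasDerivAt.sq_norm_complex (hmode τ hτ)).congr_deriv ?_
    have h1 : conj ⟪b n, g τ⟫_ℂ * (-((ν * n ^ 2 : ℝ) : ℂ) * ⟪b n, g τ⟫_ℂ) =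
        ((-(ν * n ^ 2) * ‖⟪b n, g τ⟫_ℂ‖ ^ 2 : ℝ) : ℂ) := by
      have := Complex.conj_mul' ⟪b n, g τ⟫_ℂ
      push_cast
      rw [← this]; ring
    rw [mul_add, mul_add, h1, Complex.add_re, Complex.add_re, Complex.ofReal_re, inner_conj_symm]
    ring
  · refine ContinuousOn.intervalIntegrable ?_
    rw [uIcc_of_le hst]
    exact ((continuousOn_const.mul (continuousOn_const.mul (hgn.norm.pow 2))).add
      (continuousOn_const.mul (Complex.continuous_re.comp_continuousOn
        (hgn'.mul (continuousOn_const.mul hFn))))).add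
      (continuousOn_const.mul (Complex.continuous_re.comp_continuousOn (hgn'.mul hGn)))

/-- The energy inequality for `g' = ν ∂² g + ∂ F + G`. -/
theorem sq_norm_sub_le {ν s t : ℝ} (hν : 0 < ν) (hst : s ≤ t) {g F G : ℝ → H}
    (hg : ContinuousOn g (Icc s t)) (hF : ContinuousOn F (Icc s t)) (hG : ContinuousOn G (Icc s t))
    (hmode : ∀ n : ℤ, ∀ τ ∈ Ioo s t, HasDerivAt (fun τ => ⟪b n, g τ⟫_ℂ)
      (-((ν * n ^ 2 : ℝ) : ℂ) * ⟪b n, g τ⟫_ℂ + Complex.I * n * ⟪b n, F τ⟫_ℂ + ⟪b n, G τ⟫_ℂ) τ) :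
    ‖g t‖ ^ 2 - ‖g s‖ ^ 2 ≤
      (2 * ν)⁻¹ * (∫ τ in s..t, ‖F τ‖ ^ 2) + 2 * ∫ τ in s..t, (⟪g τ, G τ⟫_ℂ).re := by
  have h1 := (hasSum_sq_norm_inner b (g t)).sub (hasSum_sq_norm_inner b (g s))
  have h2 := ((hasSum_integral_sq b hst hF).mul_left (2 * ν)⁻¹).add
    ((hasSum_integral_re_inner b hst hg hG).mul_left 2)
  refine hasSum_le (fun n => ?_) h1 h2
  have hgn : ContinuousOn (fun τ => ⟪b n, g τ⟫_ℂ) (uIcc s t) := by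
    rw [uIcc_of_le hst]; exact continuousOn_const.inner hg
  have hgn' : ContinuousOn (fun τ => ⟪g τ, b n⟫_ℂ) (uIcc s t) := by
    rw [uIcc_of_le hst]; exact hg.inner continuousOn_const
  have hFn : ContinuousOn (fun τ => ⟪b n, F τ⟫_ℂ) (uIcc s t) := by
    rw [uIcc_of_le hst]; exact continuousOn_const.inner hF
  have hGn : ContinuousOn (fun τ => ⟪b n, G τ⟫_ℂ) (uIcc s t) := by
    rw [uIcc_of_le hst]; exact continuousOn_const.inner hG
  have hc1 : ContinuousOn (fun τ => 2 * (⟪g τ, b n⟫_ℂ * ⟪b n, G τ⟫_ℂ).re) (uIcc s t) :=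
    continuousOn_const.mul (Complex.continuous_re.comp_continuousOn (hgn'.mul hGn))
  rw [sq_norm_mode_sub hst hg hF hG (hmode n), ← intervalIntegral.integral_const_mul,
    ← intervalIntegral.integral_const_mul, ← intervalIntegral.integral_add
      (ContinuousOn.intervalIntegrable (by fun_prop)) hc1.intervalIntegrable]
  refine intervalIntegral.integral_mono_on hst (ContinuousOn.intervalIntegrable ?_)
    (ContinuousOn.intervalIntegrable ?_) ?_
  · exact ((continuousOn_const.mul (continuousOn_const.mul (hgn.norm.pow 2))).add
      (continuousOn_const.mul (Complex.continuous_re.comp_continuousOn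
        (hgn'.mul (continuousOn_const.mul hFn))))).add hc1
  · exact (continuousOn_const.mul (hFn.norm.pow 2)).add hc1
  · intro τ _
    have h3 : (⟪g τ, b n⟫_ℂ * (Complex.I * n * ⟪b n, F τ⟫_ℂ)).re ≤
        ‖⟪b n, g τ⟫_ℂ‖ * (|(n : ℝ)| * ‖⟪b n, F τ⟫_ℂ‖) := by
      refine (Complex.re_le_norm _).trans_eq ?_
      rw [norm_mul, norm_mul, norm_mul, Complex.norm_I, one_mul, Complex.norm_intCast,
        norm_inner_symm]
    -- Young's inequality spends all of the dissipation of the mode on the flux `F`. After summation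
    -- no derivative of `g` is left, so `g` may be merely continuous with values in `H`.
    have h4 : 2 * (‖⟪b n, g τ⟫_ℂ‖ * (|(n : ℝ)| * ‖⟪b n, F τ⟫_ℂ‖)) ≤
        2 * ν * (n ^ 2 * ‖⟪b n, g τ⟫_ℂ‖ ^ 2) + (2 * ν)⁻¹ * ‖⟪b n, F τ⟫_ℂ‖ ^ 2 := by
      rw [← sq_abs (n : ℝ)]
      have h5 : (2 * ν) * (2 * ν)⁻¹ = 1 := mul_inv_cancel₀ (by positivity)
      have h6 : 0 < (2 * ν)⁻¹ := by positivity
      have : 0 ≤ (2 * ν)⁻¹ * (2 * ν * (|(n : ℝ)| * ‖⟪b n, g τ⟫_ℂ‖) - ‖⟪b n, F τ⟫_ℂ‖) ^ 2 := by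
        positivity
      have h7 : (2 * ν)⁻¹ * (2 * ν * (|(n : ℝ)| * ‖⟪b n, g τ⟫_ℂ‖) - ‖⟪b n, F τ⟫_ℂ‖) ^ 2 =
          ((2 * ν) * (2 * ν)⁻¹) * (2 * ν * (|(n : ℝ)| ^ 2 * ‖⟪b n, g τ⟫_ℂ‖ ^ 2)) -
          ((2 * ν) * (2 * ν)⁻¹) * (2 * (‖⟪b n, g τ⟫_ℂ‖ * (|(n : ℝ)| * ‖⟪b n, F τ⟫_ℂ‖))) +
          (2 * ν)⁻¹ * ‖⟪b n, F τ⟫_ℂ‖ ^ 2 := by ring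
      rw [h7, h5] at this
      linarith
    linarith

variable {ν T : ℝ} {f h : ℝ → H}

/-- The energy identity of each mode writes the dissipated energy as a combination of terms already
summable over `n`. -/
theorem summable_integral_sq_mode (hν : 0 < ν) (hT : 0 ≤ T) (hf : ContinuousOn f (Icc 0 T))
    (hh : ContinuousOn h (Icc 0 T))
    (hmode : ∀ n : ℤ, ∀ τ ∈ Ioo 0 T, HasDerivAt (fun τ => ⟪b n, f τ⟫_ℂ)
      (-((ν * n ^ 2 : ℝ) : ℂ) * ⟪b n, f τ⟫_ℂ + ⟪b n, h τ⟫_ℂ) τ) :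
    Summable fun n : ℤ => ∫ τ in (0 : ℝ)..T, (n : ℝ) ^ 2 * ‖⟪b n, f τ⟫_ℂ‖ ^ 2 := by
  have h1 := ((hasSum_sq_norm_inner b (f T)).sub (hasSum_sq_norm_inner b (f 0))).summable
  have h2 := ((hasSum_integral_re_inner b hT hf hh).mul_left 2).summable
  refine ((h2.sub h1).mul_left (2 * ν)⁻¹).congr fun n => ?_
  have hfn : ContinuousOn (fun τ => ⟪b n, f τ⟫_ℂ) (uIcc 0 T) := by
    rw [uIcc_of_le hT]; exact continuousOn_const.inner hf
  have hfn' : ContinuousOn (fun τ => ⟪f τ, b n⟫_ℂ) (uIcc 0 T) := by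
    rw [uIcc_of_le hT]; exact hf.inner continuousOn_const
  have hhn : ContinuousOn (fun τ => ⟪b n, h τ⟫_ℂ) (uIcc 0 T) := by
    rw [uIcc_of_le hT]; exact continuousOn_const.inner hh
  have h3 := sq_norm_mode_sub (F := fun _ => 0) (ν := ν) hT hf continuousOn_const hh
    (n := n) (by simpa using hmode n)
  simp only [inner_zero_right, mul_zero, Complex.zero_re, add_zero] at h3
  have hc : ContinuousOn (fun τ => 2 * (⟪f τ, b n⟫_ℂ * ⟪b n, h τ⟫_ℂ).re) (uIcc 0 T) :=
    continuousOn_const.mul (Complex.continuous_re.comp_continuousOn (hfn'.mul hhn))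
  rw [intervalIntegral.integral_add (ContinuousOn.intervalIntegrable (by fun_prop))
    hc.intervalIntegrable,
    intervalIntegral.integral_const_mul (-(2 * ν)), intervalIntegral.integral_const_mul 2] at h3
  rw [h3]
  field_simp
  ring

/-- Smoothing: when t n²|fₙ|² is differentiated, the dissipation of order n⁴ absorbs the forcing,
and the weight t removes the unknown initial value. The bound does not depend on `t` and is summable
in `n`. -/
theorem mul_sq_mode_le (hν : 0 < ν) (hf : ContinuousOn f (Icc 0 T))
    (hh : ContinuousOn h (Icc 0 T)) {n : ℤ}
    (hmode : ∀ τ ∈ Ioo 0 T, HasDerivAt (fun τ => ⟪b n, f τ⟫_ℂ)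
      (-((ν * n ^ 2 : ℝ) : ℂ) * ⟪b n, f τ⟫_ℂ + ⟪b n, h τ⟫_ℂ) τ) {t : ℝ} (ht : t ∈ Icc 0 T) :
    t * ((n : ℝ) ^ 2 * ‖⟪b n, f t⟫_ℂ‖ ^ 2) ≤
      (∫ τ in (0 : ℝ)..T, (n : ℝ) ^ 2 * ‖⟪b n, f τ⟫_ℂ‖ ^ 2) +
        T * (2 * ν)⁻¹ * ∫ τ in (0 : ℝ)..T, ‖⟪b n, h τ⟫_ℂ‖ ^ 2 := by
  have hT : 0 ≤ T := ht.1.trans ht.2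
  have hfn : ContinuousOn (fun τ => ⟪b n, f τ⟫_ℂ) (Icc 0 T) := continuousOn_const.inner hf
  have hhn : ContinuousOn (fun τ => ⟪b n, h τ⟫_ℂ) (Icc 0 T) := continuousOn_const.inner hh
  have hsub : Icc 0 t ⊆ Icc 0 T := Icc_subset_Icc_right ht.2
  have hc : ContinuousOn (fun τ => (n : ℝ) ^ 2 * ‖⟪b n, f τ⟫_ℂ‖ ^ 2 +
      T * (2 * ν)⁻¹ * ‖⟪b n, h τ⟫_ℂ‖ ^ 2) (Icc 0 T) :=
    (continuousOn_const.mul (hfn.norm.pow 2)).add (continuousOn_const.mul (hhn.norm.pow 2))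
  have key : t * ((n : ℝ) ^ 2 * ‖⟪b n, f t⟫_ℂ‖ ^ 2) - 0 * ((n : ℝ) ^ 2 * ‖⟪b n, f 0⟫_ℂ‖ ^ 2) ≤
      ∫ τ in (0 : ℝ)..t, ((n : ℝ) ^ 2 * ‖⟪b n, f τ⟫_ℂ‖ ^ 2 +
        T * (2 * ν)⁻¹ * ‖⟪b n, h τ⟫_ℂ‖ ^ 2) := by
    refine intervalIntegral.sub_le_integral_of_hasDeriv_right_of_le
      (g := fun τ => τ * ((n : ℝ) ^ 2 * ‖⟪b n, f τ⟫_ℂ‖ ^ 2)) ht.1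
      (continuousOn_id.mul (continuousOn_const.mul (hfn.norm.pow 2)) |>.mono hsub)
      (fun τ hτ => ((hasDerivAt_id τ).mul ((HasDerivAt.sq_norm_complex
        (hmode τ ⟨hτ.1, hτ.2.trans_le ht.2⟩)).const_mul _)).hasDerivWithinAt)
      ((hc.mono hsub).integrableOn_Icc) ?_
    intro τ hτ
    have hτT : τ ≤ T := hτ.2.le.trans ht.2
    have h1 : (conj ⟪b n, f τ⟫_ℂ * (-((ν * n ^ 2 : ℝ) : ℂ) * ⟪b n, f τ⟫_ℂ + ⟪b n, h τ⟫_ℂ)).re ≤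
        -(ν * n ^ 2) * ‖⟪b n, f τ⟫_ℂ‖ ^ 2 + ‖⟪b n, f τ⟫_ℂ‖ * ‖⟪b n, h τ⟫_ℂ‖ := by
      have h2 : conj ⟪b n, f τ⟫_ℂ * (-((ν * n ^ 2 : ℝ) : ℂ) * ⟪b n, f τ⟫_ℂ) =
          ((-(ν * n ^ 2) * ‖⟪b n, f τ⟫_ℂ‖ ^ 2 : ℝ) : ℂ) := by
        have := Complex.conj_mul' ⟪b n, f τ⟫_ℂ
        push_cast
        rw [← this]; ring
      rw [mul_add, h2, Complex.add_re, Complex.ofReal_re]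
      gcongr
      refine (Complex.re_le_norm _).trans_eq ?_
      rw [norm_mul, RCLike.norm_conj]
    set x := ‖⟪b n, f τ⟫_ℂ‖
    set y := ‖⟪b n, h τ⟫_ℂ‖
    have h5 : (2 * ν) * (2 * ν)⁻¹ = 1 := mul_inv_cancel₀ (by positivity)
    have h6 : 0 < (2 * ν)⁻¹ := by positivity
    have h7 : 0 ≤ (2 * ν)⁻¹ * (2 * ν * (n ^ 2 * x) - y) ^ 2 := by positivity
    have h8 : (2 * ν)⁻¹ * (2 * ν * (n ^ 2 * x) - y) ^ 2 =
        ((2 * ν) * (2 * ν)⁻¹) * (2 * ν * (n ^ 2 * x) ^ 2) -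
          ((2 * ν) * (2 * ν)⁻¹) * (2 * (n ^ 2 * x * y)) + (2 * ν)⁻¹ * y ^ 2 := by ring
    rw [h8, h5] at h7
    have h9 : (n : ℝ) ^ 2 * (2 * (-(ν * n ^ 2) * x ^ 2 + x * y)) ≤ (2 * ν)⁻¹ * y ^ 2 := by
      nlinarith
    have h10 : (n : ℝ) ^ 2 * (2 * (conj ⟪b n, f τ⟫_ℂ *
        (-((ν * n ^ 2 : ℝ) : ℂ) * ⟪b n, f τ⟫_ℂ + ⟪b n, h τ⟫_ℂ)).re) ≤ (2 * ν)⁻¹ * y ^ 2 :=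
      le_trans (by gcongr) h9
    have h11 : τ * ((n : ℝ) ^ 2 * (2 * (conj ⟪b n, f τ⟫_ℂ *
        (-((ν * n ^ 2 : ℝ) : ℂ) * ⟪b n, f τ⟫_ℂ + ⟪b n, h τ⟫_ℂ)).re)) ≤
        T * ((2 * ν)⁻¹ * y ^ 2) :=
      (mul_le_mul_of_nonneg_left h10 hτ.1.le).trans
        (mul_le_mul_of_nonneg_right hτT (by positivity))
    simp only [id]
    linarith
  rw [zero_mul, sub_zero] at key
  refine key.trans ?_
  rw [← uIcc_of_le hT] at hc hfn hhn
  rw [← intervalIntegral.integral_const_mul, ← intervalIntegral.integral_add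
    (ContinuousOn.intervalIntegrable (by fun_prop)) (ContinuousOn.intervalIntegrable (by fun_prop))]
  refine intervalIntegral.integral_mono_interval le_rfl ht.1 ht.2
    (Filter.Eventually.of_forall fun τ => ?_) hc.intervalIntegrable
  simp only [Pi.zero_apply]
  positivity

theorem exists_summable_bound_mode (hν : 0 < ν) (hT : 0 ≤ T) (hf : ContinuousOn f (Icc 0 T))
    (hh : ContinuousOn h (Icc 0 T))
    (hmode : ∀ n : ℤ, ∀ τ ∈ Ioo 0 T, HasDerivAt (fun τ => ⟪b n, f τ⟫_ℂ)
      (-((ν * n ^ 2 : ℝ) : ℂ) * ⟪b n, f τ⟫_ℂ + ⟪b n, h τ⟫_ℂ) τ) :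
    ∃ B : ℤ → ℝ, Summable B ∧ ∀ n : ℤ, ∀ t ∈ Icc 0 T,
      t * ((n : ℝ) ^ 2 * ‖⟪b n, f t⟫_ℂ‖ ^ 2) ≤ B n :=
  ⟨_, (summable_integral_sq_mode hν hT hf hh hmode).add
    ((hasSum_integral_sq b hT hh).summable.mul_left _),
    fun n _ ht => mul_sq_mode_le hν hf hh (hmode n) ht⟩

theorem hasDer_of_heat (hν : 0 < ν) (hf : ContinuousOn f (Icc 0 T))
    (hh : ContinuousOn h (Icc 0 T))
    (hmode : ∀ n : ℤ, ∀ τ ∈ Ioo 0 T, HasDerivAt (fun τ => ⟪b n, f τ⟫_ℂ)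
      (-((ν * n ^ 2 : ℝ) : ℂ) * ⟪b n, f τ⟫_ℂ + ⟪b n, h τ⟫_ℂ) τ) {t : ℝ} (ht : t ∈ Ioc 0 T) :
    HasDer b (f t) (der b (f t)) := by
  obtain ⟨B, hB, hle⟩ := exists_summable_bound_mode hν (ht.1.le.trans ht.2) hf hh hmode
  refine hasDer_der (Summable.of_nonneg_of_le (fun n => by positivity) (fun n => ?_)
    (hB.mul_left t⁻¹))
  rw [← div_eq_inv_mul, le_div_iff₀ ht.1, mul_comm]
  exact hle n t ⟨ht.1.le, ht.2⟩

/-- Away from time zero the smoothing bound is a summable majorant uniform in time, so the series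
for the squared norm of the difference of derivatives is continuous in `t`. -/
theorem continuousOn_der_of_heat (hν : 0 < ν) (hf : ContinuousOn f (Icc 0 T))
    (hh : ContinuousOn h (Icc 0 T))
    (hmode : ∀ n : ℤ, ∀ τ ∈ Ioo 0 T, HasDerivAt (fun τ => ⟪b n, f τ⟫_ℂ)
      (-((ν * n ^ 2 : ℝ) : ℂ) * ⟪b n, f τ⟫_ℂ + ⟪b n, h τ⟫_ℂ) τ) {s : ℝ} (hs : 0 < s) :
    ContinuousOn (fun t => der b (f t)) (Icc s T) := by
  intro t₀ ht₀
  have hT : 0 ≤ T := hs.le.trans (ht₀.1.trans ht₀.2)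
  obtain ⟨B, hB, hle⟩ := exists_summable_bound_mode hν hT hf hh hmode
  have hD : ∀ t ∈ Icc s T, HasDer b (f t) (der b (f t)) := fun t ht =>
    hasDer_of_heat hν hf hh hmode ⟨hs.trans_le ht.1, ht.2⟩
  have hsub : Icc s T ⊆ Icc 0 T := Icc_subset_Icc_left hs.le
  have hB' : ∀ n : ℤ, ∀ t ∈ Icc s T, (n : ℝ) ^ 2 * ‖⟪b n, f t⟫_ℂ‖ ^ 2 ≤ s⁻¹ * B n := by
    intro n t ht
    rw [← div_eq_inv_mul, le_div_iff₀ hs]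
    refine le_trans ?_ (hle n t (hsub ht))
    rw [mul_comm]
    exact mul_le_mul_of_nonneg_right ht.1 (by positivity)
  have hcont : ContinuousOn (fun t => ∑' n : ℤ, (n : ℝ) ^ 2 * ‖⟪b n, f t - f t₀⟫_ℂ‖ ^ 2)
      (Icc s T) := by
    refine continuousOn_tsum (u := fun n => 4 * (s⁻¹ * B n)) (fun n => ?_)
      ((hB.mul_left _).mul_left _) (fun n t ht => ?_)
    · exact continuousOn_const.mul ((continuousOn_const.inner
        ((hf.mono hsub).sub continuousOn_const)).norm.pow 2)
    · rw [Real.norm_of_nonneg (by positivity), inner_sub_right]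
      have h1 := norm_sub_le ⟪b n, f t⟫_ℂ ⟪b n, f t₀⟫_ℂ
      have h2 : ‖⟪b n, f t⟫_ℂ - ⟪b n, f t₀⟫_ℂ‖ ^ 2 ≤
          2 * ‖⟪b n, f t⟫_ℂ‖ ^ 2 + 2 * ‖⟪b n, f t₀⟫_ℂ‖ ^ 2 := by
        nlinarith [sq_nonneg (‖⟪b n, f t⟫_ℂ‖ - ‖⟪b n, f t₀⟫_ℂ‖),
          norm_nonneg (⟪b n, f t⟫_ℂ - ⟪b n, f t₀⟫_ℂ)]
      have h3 := mul_le_mul_of_nonneg_left h2 (sq_nonneg (n : ℝ))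
      linarith [hB' n t ht, hB' n t₀ ht₀]
  have heq : ∀ t ∈ Icc s T, ∑' n : ℤ, (n : ℝ) ^ 2 * ‖⟪b n, f t - f t₀⟫_ℂ‖ ^ 2 =
      ‖der b (f t) - der b (f t₀)‖ ^ 2 := by
    intro t ht
    rw [← (hasSum_sq_norm_inner b (der b (f t) - der b (f t₀))).tsum_eq]
    exact tsum_congr fun n => (((hD t ht).sub (hD t₀ ht₀)).sq_norm n).symm
  have h1 : Filter.Tendsto (fun t => ‖der b (f t) - der b (f t₀)‖ ^ 2)
      (nhdsWithin t₀ (Icc s T)) (nhds 0) := by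
    have h2 := hcont t₀ ht₀
    rw [ContinuousWithinAt, heq t₀ ht₀, sub_self, norm_zero, zero_pow two_ne_zero] at h2
    exact h2.congr' (eventually_nhdsWithin_of_forall heq)
  have h3 := (Real.continuous_sqrt.tendsto 0).comp h1
  rw [Real.sqrt_zero] at h3
  refine tendsto_iff_norm_sub_tendsto_zero.2 (h3.congr fun t => ?_)
  exact Real.sqrt_sq (norm_nonneg _)

theorem integral_sq_norm_der (hν : 0 < ν) (hf : ContinuousOn f (Icc 0 T))
    (hh : ContinuousOn h (Icc 0 T))
    (hmode : ∀ n : ℤ, ∀ τ ∈ Ioo 0 T, HasDerivAt (fun τ => ⟪b n, f τ⟫_ℂ)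
      (-((ν * n ^ 2 : ℝ) : ℂ) * ⟪b n, f τ⟫_ℂ + ⟪b n, h τ⟫_ℂ) τ) {s t : ℝ} (hs : 0 < s)
    (hst : s ≤ t) (ht : t ≤ T) :
    ‖f t‖ ^ 2 - ‖f s‖ ^ 2 = -(2 * ν) * (∫ τ in s..t, ‖der b (f τ)‖ ^ 2) +
      2 * ∫ τ in s..t, (⟪f τ, h τ⟫_ℂ).re := by
  have hsub : Icc s t ⊆ Icc 0 T := Icc_subset_Icc hs.le ht
  have hf' := hf.mono hsub
  have hh' := hh.mono hsub
  have hd : ContinuousOn (fun t => der b (f t)) (Icc s t) :=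
    (continuousOn_der_of_heat hν hf hh hmode hs).mono (Icc_subset_Icc_right ht)
  have h1 := (hasSum_sq_norm_inner b (f t)).sub (hasSum_sq_norm_inner b (f s))
  have h2 := ((hasSum_integral_sq b hst hd).mul_left (-(2 * ν))).add
    ((hasSum_integral_re_inner b hst hf' hh').mul_left 2)
  refine h1.unique (h2.congr_fun fun n => ?_)
  have h3 := sq_norm_mode_sub (F := fun _ => 0) (ν := ν) hst hf' continuousOn_const hh' (n := n)
    (fun τ hτ => by simpa using hmode n τ ⟨hs.trans hτ.1, hτ.2.trans_le ht⟩)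
  simp only [inner_zero_right, mul_zero, Complex.zero_re, add_zero] at h3
  rw [← uIcc_of_le hst] at hf' hh'
  have hfn : ContinuousOn (fun τ => ⟪b n, f τ⟫_ℂ) (uIcc s t) := continuousOn_const.inner hf'
  have hc : ContinuousOn (fun τ => 2 * (⟪f τ, b n⟫_ℂ * ⟪b n, h τ⟫_ℂ).re) (uIcc s t) :=
    continuousOn_const.mul (Complex.continuous_re.comp_continuousOn
      ((hf'.inner continuousOn_const).mul (continuousOn_const.inner hh')))
  rw [h3, intervalIntegral.integral_add (ContinuousOn.intervalIntegrable (by fun_prop))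
    hc.intervalIntegrable,
    intervalIntegral.integral_const_mul (-(2 * ν)), intervalIntegral.integral_const_mul 2]
  congr 2
  refine intervalIntegral.integral_congr fun τ hτ => ?_
  rw [uIcc_of_le hst] at hτ
  exact ((hasDer_of_heat hν hf hh hmode
    ⟨hs.trans_le hτ.1, hτ.2.trans ht⟩).sq_norm n).symm

/-- The weak form of the equation against test vectors with one derivative. -/
theorem hasDerivAt_inner_of_heat (hν : 0 < ν) (hf : ContinuousOn f (Icc 0 T))
    (hh : ContinuousOn h (Icc 0 T))
    (hmode : ∀ n : ℤ, ∀ τ ∈ Ioo 0 T, HasDerivAt (fun τ => ⟪b n, f τ⟫_ℂ)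
      (-((ν * n ^ 2 : ℝ) : ℂ) * ⟪b n, f τ⟫_ℂ + ⟪b n, h τ⟫_ℂ) τ) {φ ψ : H} (hφ : HasDer b φ ψ)
    {t : ℝ} (ht : t ∈ Ioo 0 T) :
    HasDerivAt (fun t => ⟪φ, f t⟫_ℂ) (-(ν : ℂ) * ⟪ψ, der b (f t)⟫_ℂ + ⟪φ, h t⟫_ℂ) t := by
  -- The derivative is controlled only at positive times, so the integrated identity starts from
  -- some `s` strictly between 0 and `t`.
  obtain ⟨s, hs0, hst⟩ := exists_between ht.1
  have hfs : ContinuousOn f (Icc s T) := hf.mono (Icc_subset_Icc_left hs0.le)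
  have hhs : ContinuousOn h (Icc s T) := hh.mono (Icc_subset_Icc_left hs0.le)
  have hd : ContinuousOn (fun t => der b (f t)) (Icc s T) :=
    continuousOn_der_of_heat hν hf hh hmode hs0
  have hcont : ContinuousOn (fun t => -(ν : ℂ) * ⟪ψ, der b (f t)⟫_ℂ + ⟪φ, h t⟫_ℂ) (Icc s T) :=
    (continuousOn_const.mul (continuousOn_const.inner hd)).add (continuousOn_const.inner hhs)
  have hint : ∀ r ∈ Ioo s T, ⟪φ, f r⟫_ℂ = ⟪φ, f s⟫_ℂ +
      ∫ τ in s..r, (-(ν : ℂ) * ⟪ψ, der b (f τ)⟫_ℂ + ⟪φ, h τ⟫_ℂ) := by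
    intro r hr
    have hsub : Icc s r ⊆ Icc s T := Icc_subset_Icc_right hr.2.le
    have hd' := hd.mono hsub
    have hh' := hhs.mono hsub
    have hf' := hfs.mono hsub
    have hsr : s ≤ r := hr.1.le
    have h1 := (b.hasSum_inner_mul_inner φ (f r)).sub (b.hasSum_inner_mul_inner φ (f s))
    have h2 := ((hasSum_integral_inner b hsr (continuousOn_const (c := ψ)) hd').mul_left
      (-(ν : ℂ))).add (hasSum_integral_inner b hsr (continuousOn_const (c := φ)) hh')
    rw [← sub_eq_iff_eq_add']
    have hu : uIcc s r = Icc s r := uIcc_of_le hsr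
    rw [intervalIntegral.integral_add
      (ContinuousOn.intervalIntegrable
        (by rw [hu]; exact continuousOn_const.mul (continuousOn_const.inner hd')))
      (ContinuousOn.intervalIntegrable (by rw [hu]; exact continuousOn_const.inner hh')),
      intervalIntegral.integral_const_mul]
    refine h1.unique (h2.congr_fun fun n => ?_)
    have hfn : ContinuousOn (fun τ => ⟪b n, f τ⟫_ℂ) (Icc s r) := continuousOn_const.inner hf'
    have hhn : ContinuousOn (fun τ => ⟪b n, h τ⟫_ℂ) (Icc s r) := continuousOn_const.inner hh'
    have h3 : ∫ τ in s..r, (-((ν * n ^ 2 : ℝ) : ℂ) * ⟪b n, f τ⟫_ℂ + ⟪b n, h τ⟫_ℂ) =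
        ⟪b n, f r⟫_ℂ - ⟪b n, f s⟫_ℂ :=
      intervalIntegral.integral_eq_sub_of_hasDerivAt_of_le hsr hfn
        (fun τ hτ => hmode n τ ⟨hs0.trans hτ.1, hτ.2.trans hr.2⟩)
        (ContinuousOn.intervalIntegrable (by
          rw [hu]; exact (continuousOn_const.mul hfn).add hhn))
    rw [← mul_sub, ← h3, ← intervalIntegral.integral_const_mul,
      ← intervalIntegral.integral_const_mul, ← intervalIntegral.integral_add
      (ContinuousOn.intervalIntegrable (by
        rw [hu]
        exact continuousOn_const.mul (continuousOn_const.mul (continuousOn_const.inner hd'))))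
      (ContinuousOn.intervalIntegrable (by rw [hu]; exact continuousOn_const.mul hhn))]
    refine intervalIntegral.integral_congr fun τ hτ => ?_
    rw [hu] at hτ
    have h4 := hasDer_of_heat hν hf hh hmode (t := τ)
      ⟨hs0.trans_le hτ.1, hτ.2.trans hr.2.le⟩ n
    have h5 : ⟪ψ, b n⟫_ℂ = -(Complex.I * n) * ⟪φ, b n⟫_ℂ := by
      rw [← inner_conj_symm ψ, hφ n, ← inner_conj_symm φ]
      simp
    simp only [h4, h5]
    push_cast
    linear_combination (-(ν : ℂ) * n ^ 2 * ⟪φ, b n⟫_ℂ * ⟪b n, f τ⟫_ℂ) * Complex.I_sq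
  have hmem : Icc s T ∈ nhds t := Icc_mem_nhds hst ht.2
  have hd2 := intervalIntegral.integral_hasDerivAt_right (a := s) (b := t)
    (ContinuousOn.intervalIntegrable (hcont.mono (by
      rw [uIcc_of_le hst.le]; exact Icc_subset_Icc_right ht.2.le)))
    (hcont.stronglyMeasurableAtFilter_nhdsWithin measurableSet_Icc t |>.filter_mono (by
      rw [nhdsWithin_eq_nhds.2 hmem]))
    (hcont.continuousAt hmem)
  refine (hd2.const_add ⟪φ, f s⟫_ℂ).congr_of_eventuallyEq ?_
  filter_upwards [Ioo_mem_nhds hst ht.2] with r hr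
  exact hint r hr

end HeatFlow

/-! ### A Grönwall lemma and the memory function. -/

/-- Grönwall with the right endpoint fixed and no differentiability of `Ψ`: as a function of `s`,
(Ψ(b) + ∫ₛᵇ rΨ) exp(−∫ₛᵇ r) is nonincreasing, and it is compared at `s = a` and `s = b`. -/
theorem le_mul_exp_of_integral_le {a b : ℝ} (hab : a ≤ b) {Ψ r : ℝ → ℝ}
    (hΨ : ContinuousOn Ψ (Icc a b)) (hr : ContinuousOn r (Icc a b)) (hr0 : ∀ t ∈ Icc a b, 0 ≤ r t)
    (hle : ∀ s ∈ Icc a b, Ψ b - Ψ s ≤ -∫ τ in s..b, r τ * Ψ τ) :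
    Ψ b ≤ Ψ a * exp (-∫ τ in a..b, r τ) := by
  have hu : uIcc a b = Icc a b := uIcc_of_le hab
  have hrΨ := hr.mul hΨ
  have hI : ∀ φ : ℝ → ℝ, ContinuousOn φ (Icc a b) →
      ContinuousOn (fun s => ∫ τ in s..b, φ τ) (Icc a b) := fun φ hφ => by
    rw [← hu] at hφ ⊢
    have := intervalIntegral.continuousOn_primitive_interval' (μ := volume)
      hφ.intervalIntegrable (right_mem_uIcc (a := a) (b := b))
    refine this.neg.congr fun s _ => ?_
    simp only [Pi.neg_apply]
    rw [intervalIntegral.integral_symm]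
  have hD : ∀ φ : ℝ → ℝ, ContinuousOn φ (Icc a b) → ∀ s ∈ Ioo a b,
      HasDerivAt (fun s => ∫ τ in s..b, φ τ) (-φ s) s := fun φ hφ s hs => by
    have hmem : Icc a b ∈ nhds s := Icc_mem_nhds hs.1 hs.2
    refine intervalIntegral.integral_hasDerivAt_left
      (ContinuousOn.intervalIntegrable (hφ.mono ?_)) ?_ (hφ.continuousAt hmem)
    · rw [uIcc_of_le hs.2.le]; exact Icc_subset_Icc_left hs.1.le
    · refine (hφ.stronglyMeasurableAtFilter_nhdsWithin measurableSet_Icc s).filter_mono ?_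
      rw [nhdsWithin_eq_nhds.2 hmem]
  have hanti : AntitoneOn (fun s => (Ψ b + ∫ τ in s..b, r τ * Ψ τ) *
      exp (-∫ τ in s..b, r τ)) (Icc a b) := by
    have hder : ∀ s ∈ Ioo a b, HasDerivAt (fun s => (Ψ b + ∫ τ in s..b, r τ * Ψ τ) *
        exp (-∫ τ in s..b, r τ))
        ((-(r s * Ψ s)) * exp (-∫ τ in s..b, r τ) +
          (Ψ b + ∫ τ in s..b, r τ * Ψ τ) * (exp (-∫ τ in s..b, r τ) * -(-r s))) s :=
      fun s hs => ((hD _ hrΨ s hs).const_add _).mul ((hD _ hr s hs).neg.exp)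
    refine antitoneOn_of_deriv_nonpos (convex_Icc a b)
      ((continuousOn_const.add (hI _ hrΨ)).mul (hI _ hr).neg.rexp) ?_ ?_ <;> rw [interior_Icc]
    · exact fun s hs => (hder s hs).differentiableAt.differentiableWithinAt
    · intro s hs
      rw [(hder s hs).deriv]
      have h1 := hle s (Ioo_subset_Icc_self hs)
      have h2 : 0 ≤ r s * exp (-∫ τ in s..b, r τ) :=
        mul_nonneg (hr0 s (Ioo_subset_Icc_self hs)) (exp_pos _).le
      nlinarith
  have h1 := hanti (left_mem_Icc.2 hab) (right_mem_Icc.2 hab) hab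
  simp only [intervalIntegral.integral_same, add_zero, neg_zero, exp_zero, mul_one] at h1
  refine h1.trans (mul_le_mul_of_nonneg_right ?_ (exp_pos _).le)
  have := hle a (left_mem_Icc.2 hab)
  linarith

/-- The solution of `Y' = ξ - κ Y`, `Y(t₁) = 1 / κ`. -/
theorem exists_memory {κ T t₁ : ℝ} (hκ : 0 < κ) {ξ : ℝ → ℝ} (hξ : ContinuousOn ξ (Icc 0 T))
    (h01 : ∀ t ∈ Icc 0 T, 0 ≤ ξ t ∧ ξ t ≤ 1)
    (hlip : ∀ s t, 0 ≤ s → s ≤ t → t ≤ T → ξ t - ξ s ≤ κ / 2 * (t - s)) (ht₁ : t₁ ∈ Icc 0 T) :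
    ∃ Y : ℝ → ℝ, Continuous Y ∧ Y t₁ = 1 / κ ∧
      (∀ t ∈ Ioo t₁ T, HasDerivAt Y (ξ t - κ * Y t) t) ∧
      (∀ t ∈ Icc t₁ T, 0 ≤ Y t ∧ κ * Y t ≤ 1) ∧
      ∀ t ∈ Icc t₁ T, ∫ τ in t₁..t, ξ τ ^ 3 ≤ 6 * κ ^ 2 * ∫ τ in t₁..t, Y τ ^ 2 := by
  have hT : 0 ≤ T := ht₁.1.trans ht₁.2
  -- Extending `ξ` by constants outside the interval makes the Duhamel formula for `Y`
  -- differentiable on the whole line.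
  set ζ : ℝ → ℝ := IccExtend hT ((Icc 0 T).domRestrict ξ) with hζ
  have hζc : Continuous ζ := (continuousOn_iff_continuous_domRestrict.1 hξ).Icc_extend'
  have hζe : ∀ t ∈ Icc 0 T, ζ t = ξ t := fun t ht => IccExtend_of_mem hT _ ht
  have hζ01 : ∀ t, 0 ≤ ζ t ∧ ζ t ≤ 1 := fun t => h01 _ (projIcc 0 T hT t).2
  have hEc : Continuous fun τ => exp (κ * (τ - t₁)) := by fun_prop
  have hζE : Continuous fun τ => exp (κ * (τ - t₁)) * ζ τ := hEc.mul hζc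
  set J : ℝ → ℝ := fun t => ∫ τ in t₁..t, exp (κ * (τ - t₁)) * ζ τ with hJ
  have hJd : ∀ t, HasDerivAt J (exp (κ * (t - t₁)) * ζ t) t := fun t =>
    intervalIntegral.integral_hasDerivAt_right (hζE.intervalIntegrable _ _)
      hζE.stronglyMeasurable.stronglyMeasurableAtFilter hζE.continuousAt
  have hEd : ∀ t, HasDerivAt (fun τ => exp (κ * (τ - t₁))) (exp (κ * (t - t₁)) * κ) t := fun t => by
    have := (((hasDerivAt_id t).sub_const t₁).const_mul κ).exp
    simpa using this
  set Y : ℝ → ℝ := fun t => exp (-(κ * (t - t₁))) * (1 / κ + J t) with hY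
  have hYd : ∀ t, HasDerivAt Y (ζ t - κ * Y t) t := fun t => by
    have h1 : HasDerivAt (fun τ => exp (-(κ * (τ - t₁)))) (exp (-(κ * (t - t₁))) * (-κ)) t := by
      have := (((hasDerivAt_id t).sub_const t₁).const_mul κ).neg.exp
      simpa using this
    refine (h1.mul ((hJd t).const_add (1 / κ))).congr_deriv ?_
    have h2 : exp (-(κ * (t - t₁))) * exp (κ * (t - t₁)) = 1 := by
      rw [← exp_add]; simp
    simp only [hY]
    linear_combination (ζ t) * h2
  have hYc : Continuous Y := continuous_iff_continuousAt.2 fun t => (hYd t).continuousAt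
  have hJ0 : ∀ t, t₁ ≤ t → 0 ≤ J t := fun t ht =>
    intervalIntegral.integral_nonneg ht fun τ _ => mul_nonneg (exp_pos _).le (hζ01 τ).1
  have hY0 : ∀ t, t₁ ≤ t → 0 ≤ Y t := fun t ht =>
    mul_nonneg (exp_pos _).le (add_nonneg (by positivity) (hJ0 t ht))
  have hY1 : ∀ t, t₁ ≤ t → κ * Y t ≤ 1 := fun t ht => by
    have h1 : J t ≤ ∫ τ in t₁..t, exp (κ * (τ - t₁)) :=
      intervalIntegral.integral_mono_on ht (hζE.intervalIntegrable _ _)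
        (hEc.intervalIntegrable _ _) fun τ _ => mul_le_of_le_one_right (exp_pos _).le (hζ01 τ).2
    have h2 : ∫ τ in t₁..t, exp (κ * (τ - t₁)) * κ = exp (κ * (t - t₁)) - exp (κ * (t₁ - t₁)) :=
      intervalIntegral.integral_eq_sub_of_hasDerivAt (fun τ _ => hEd τ)
        ((hEc.mul continuous_const).intervalIntegrable _ _)
    rw [intervalIntegral.integral_mul_const, sub_self, mul_zero, exp_zero] at h2
    have h3 : κ * (1 / κ + J t) ≤ exp (κ * (t - t₁)) := by
      rw [mul_add, mul_one_div_cancel hκ.ne']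
      nlinarith
    calc κ * Y t = exp (-(κ * (t - t₁))) * (κ * (1 / κ + J t)) := by simp only [hY]; ring
      _ ≤ exp (-(κ * (t - t₁))) * exp (κ * (t - t₁)) :=
          mul_le_mul_of_nonneg_left h3 (exp_pos _).le
      _ = 1 := by rw [← exp_add]; simp
  -- As `ξ` rises at speed at most κ/2, it is at least ξ(t)/2 throughout the window of length ξ(t)/κ
  -- before `t`. That window contributes at least exp(−ξ(t)) ξ(t)²/(2κ) to `Y t`, and exp(−ξ(t)) ≥
  -- 1/3. If the window reaches back beyond `t₁`, the initial value 1/κ suffices instead.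
  have hlow : ∀ t ∈ Icc t₁ T, ξ t ^ 2 ≤ 6 * κ * Y t := by
    intro t ht
    obtain ⟨hx0, hx1⟩ := h01 t ⟨ht₁.1.trans ht.1, ht.2⟩
    have he : ∀ x : ℝ, x ≤ 1 → 1 ≤ 3 * exp (-x) := fun x hx => by
      have h1 : exp x ≤ 3 := (exp_le_exp.2 hx).trans (exp_one_lt_d9.le.trans (by norm_num))
      have h2 : exp x * exp (-x) = 1 := by rw [← exp_add]; simp
      nlinarith [exp_pos (-x)]
    by_cases hcase : κ * (t - t₁) ≤ ξ t
    · have h1 := he _ (hcase.trans hx1)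
      have h2 : exp (-(κ * (t - t₁))) * (1 / κ) ≤ Y t :=
        mul_le_mul_of_nonneg_left (by linarith [hJ0 t ht.1]) (exp_pos _).le
      have h3 : exp (-(κ * (t - t₁))) ≤ κ * Y t := by
        calc exp (-(κ * (t - t₁))) = κ * (exp (-(κ * (t - t₁))) * (1 / κ)) := by field_simp
          _ ≤ _ := mul_le_mul_of_nonneg_left h2 hκ.le
      nlinarith
    · push Not at hcase
      set l := ξ t / κ with hl
      have hl0 : 0 ≤ l := by positivity
      have hκl : κ * l = ξ t := by rw [hl]; field_simp
      have hlt : t₁ ≤ t - l := by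
        have : κ * l ≤ κ * (t - t₁) := by rw [hκl]; exact hcase.le
        linarith [le_of_mul_le_mul_left this hκ]
      have h1 : ∫ _τ in (t - l)..t, exp (κ * (t - l - t₁)) * (ξ t / 2) ≤ J t := by
        have h2 : ∫ τ in (t - l)..t, exp (κ * (τ - t₁)) * ζ τ ≤ J t :=
          intervalIntegral.integral_mono_interval hlt (by linarith) le_rfl
            (Filter.Eventually.of_forall fun τ => mul_nonneg (exp_pos _).le (hζ01 τ).1)
            (hζE.intervalIntegrable _ _)
        refine le_trans (intervalIntegral.integral_mono_on (by linarith)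
          (continuous_const.intervalIntegrable _ _) (hζE.intervalIntegrable _ _)
          fun τ hτ => ?_) h2
        have hτ0 : 0 ≤ τ := ht₁.1.trans (hlt.trans hτ.1)
        have h3 := hlip τ t hτ0 hτ.2 ht.2
        rw [hζe τ ⟨hτ0, hτ.2.trans ht.2⟩]
        refine mul_le_mul (exp_le_exp.2 ?_) ?_ (by positivity) (exp_pos _).le
        · exact mul_le_mul_of_nonneg_left (by linarith [hτ.1]) hκ.le
        · have h4 : κ / 2 * (t - τ) ≤ κ / 2 * l :=
            mul_le_mul_of_nonneg_left (by linarith [hτ.1]) (by positivity)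
          linarith
      rw [intervalIntegral.integral_const, smul_eq_mul, sub_sub_cancel] at h1
      have h5 : exp (-(κ * (t - t₁))) * (l * (exp (κ * (t - l - t₁)) * (ξ t / 2))) ≤ Y t :=
        mul_le_mul_of_nonneg_left (by have : 0 ≤ 1 / κ := by positivity
                                      linarith) (exp_pos _).le
      have h6 : exp (-(κ * (t - t₁))) * exp (κ * (t - l - t₁)) = exp (-ξ t) := by
        rw [← exp_add, ← hκl]; ring_nf
      have h7 : exp (-ξ t) * (ξ t * ξ t / 2) ≤ κ * Y t := by
        calc exp (-ξ t) * (ξ t * ξ t / 2)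
            = κ * (exp (-(κ * (t - t₁))) * (l * (exp (κ * (t - l - t₁)) * (ξ t / 2)))) := by
              rw [← h6]
              linear_combination (-(exp (-(κ * (t - t₁))) * exp (κ * (t - l - t₁)) *
                (ξ t / 2))) * hκl
          _ ≤ _ := mul_le_mul_of_nonneg_left h5 hκ.le
      nlinarith [he _ hx1, mul_nonneg hx0 hx0]
  have hYt₁ : Y t₁ = 1 / κ := by simp [hY, hJ]
  refine ⟨Y, hYc, hYt₁, fun t ht => ?_, fun t ht => ⟨hY0 t ht.1, hY1 t ht.1⟩, fun t ht => ?_⟩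
  · rw [← hζe t ⟨ht₁.1.trans ht.1.le, ht.2.le⟩]
    exact hYd t
  -- Since `Y t₁ = 1 / κ` is the largest value allowed, Y² has no net growth. Integrating (Y²)' then
  -- gives ∫Yξ ≤ κ∫Y², to be combined with ξ³ ≤ 6κYξ.
  have h1 : ∫ τ in t₁..t, (2 * (Y τ * ζ τ) - 2 * κ * Y τ ^ 2) = Y t ^ 2 - Y t₁ ^ 2 :=
    intervalIntegral.integral_eq_sub_of_hasDerivAt (f := fun τ => Y τ ^ 2)
      (fun τ _ => ((hYd τ).pow 2).congr_deriv (by push_cast; ring))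
      (Continuous.intervalIntegrable (by fun_prop) _ _)
  have hYζ : Continuous fun τ => Y τ * ζ τ := hYc.mul hζc
  have hYY : Continuous fun τ => Y τ ^ 2 := hYc.pow 2
  rw [intervalIntegral.integral_sub
    (Continuous.intervalIntegrable (by fun_prop) _ _)
    (Continuous.intervalIntegrable (by fun_prop) _ _), intervalIntegral.integral_const_mul,
    intervalIntegral.integral_const_mul] at h1
  have h2 : Y t ^ 2 ≤ Y t₁ ^ 2 := by
    refine pow_le_pow_left₀ (hY0 t ht.1) ?_ 2
    rw [hYt₁, le_div_iff₀ hκ, mul_comm]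
    exact hY1 t ht.1
  have h3 : ∫ τ in t₁..t, ξ τ ^ 3 ≤ ∫ τ in t₁..t, 6 * κ * (Y τ * ζ τ) := by
    have hsub : uIcc t₁ t ⊆ Icc 0 T := by
      rw [uIcc_of_le ht.1]; exact Icc_subset_Icc ht₁.1 ht.2
    refine intervalIntegral.integral_mono_on ht.1
      (((hξ.mono hsub).pow 3).intervalIntegrable)
      ((continuous_const.mul hYζ).intervalIntegrable _ _) fun τ hτ => ?_
    have hτ' : τ ∈ Icc t₁ T := ⟨hτ.1, hτ.2.trans ht.2⟩
    have hτ'' : τ ∈ Icc 0 T := ⟨ht₁.1.trans hτ.1, hτ'.2⟩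
    rw [hζe τ hτ'']
    have := mul_le_mul_of_nonneg_right (hlow τ hτ') (h01 τ hτ'').1
    calc ξ τ ^ 3 = ξ τ ^ 2 * ξ τ := by ring
      _ ≤ _ := this
      _ = _ := by ring
  rw [intervalIntegral.integral_const_mul] at h3
  have h4 : (∫ τ in t₁..t, Y τ * ζ τ) ≤ κ * ∫ τ in t₁..t, Y τ ^ 2 := by linarith
  calc _ ≤ _ := h3
    _ ≤ 6 * κ * (κ * ∫ τ in t₁..t, Y τ ^ 2) := mul_le_mul_of_nonneg_left h4 (by positivity)
    _ = _ := by ring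

/-! ### The hypocoercive functional and its decay. -/

section Hypocoercivity

variable {H : Type*} [NormedAddCommGroup H] [InnerProductSpace ℂ H] {b : HilbertBasis ℤ ℂ H}

/-- The operators `V`, `V₁`, `V₂` behave like multiplication by a real function and its first two
derivatives, and a spectral gap inequality with constant `c₀` holds. -/
structure IsShear (b : HilbertBasis ℤ ℂ H) (V V₁ V₂ : H →L[ℂ] H) (K c₀ : ℝ) : Prop where
  symm : ∀ x y, ⟪V x, y⟫_ℂ = ⟪x, V y⟫_ℂ
  symm₁ : ∀ x y, ⟪V₁ x, y⟫_ℂ = ⟪x, V₁ y⟫_ℂ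
  symm₂ : ∀ x y, ⟪V₂ x, y⟫_ℂ = ⟪x, V₂ y⟫_ℂ
  comm : ∀ x, V₁ (V x) = V (V₁ x)
  prod : ∀ {f h}, HasDer b f h → HasDer b (V f) (V₁ f + V h)
  prod₁ : ∀ {f h}, HasDer b f h → HasDer b (V₁ f) (V₂ f + V₁ h)
  bound₁ : ∀ x, ‖V₁ x‖ ≤ K * ‖x‖
  bound₂ : ∀ x, ‖V₂ x‖ ≤ K * ‖x‖
  gap : ∀ {f h}, HasDer b f h → ∀ ε : ℝ, 0 < ε → ε ≤ 1 →
    c₀ * ε * ‖f‖ ^ 2 ≤ ε ^ 2 * ‖h‖ ^ 2 + ‖V₁ f‖ ^ 2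

variable {V V₁ V₂ : H →L[ℂ] H} {K c₀ : ℝ}

theorem re_inner_I_smul_symm {S : H →L[ℂ] H} (hS : ∀ x y, ⟪S x, y⟫_ℂ = ⟪x, S y⟫_ℂ) (a : ℝ) (x : H) :
    (⟪x, (-(Complex.I * a)) • S x⟫_ℂ).re = 0 := by
  have h : (⟪x, S x⟫_ℂ).im = 0 := by
    have h1 : conj ⟪x, S x⟫_ℂ = ⟪x, S x⟫_ℂ := by rw [inner_conj_symm, hS]
    exact Complex.conj_eq_iff_im.1 h1
  rw [inner_smul_right]
  simp [h]

variable {ν κ k T : ℝ} {ξ : ℝ → ℝ} {f : ℝ → H}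

/-- The key cancellation: the forcing −ikξ v' f of ∂f is annihilated by the `ξ` in Y' = ξ − κY. The
commutator of v' with ν∂² is split as ∂(v'' f) + v'' ∂f, so only two derivatives of the shear are
needed. -/
theorem IsShear.hasDerivAt_mode (hV : IsShear b V V₁ V₂ K c₀) (hν : 0 < ν)
    (hξ : ContinuousOn ξ (Icc 0 T)) (hf : ContinuousOn f (Icc 0 T))
    (hmode : ∀ n : ℤ, ∀ τ ∈ Ioo 0 T, HasDerivAt (fun τ => ⟪b n, f τ⟫_ℂ)
      (-((ν * n ^ 2 : ℝ) : ℂ) * ⟪b n, f τ⟫_ℂ + ⟪b n, (-(Complex.I * (k * ξ τ : ℝ))) • V (f τ)⟫_ℂ) τ)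
    {Y : ℝ → ℝ} {t : ℝ} (ht : t ∈ Ioo 0 T) (hY : HasDerivAt Y (ξ t - κ * Y t) t) (n : ℤ) :
    HasDerivAt (fun τ => ⟪b n, der b (f τ) + (Complex.I * (k * Y τ : ℝ)) • V₁ (f τ)⟫_ℂ)
      (-((ν * n ^ 2 : ℝ) : ℂ) * ⟪b n, der b (f t) + (Complex.I * (k * Y t : ℝ)) • V₁ (f t)⟫_ℂ +
        Complex.I * n * ⟪b n, (-(Complex.I * (ν * k * Y t : ℝ))) • V₂ (f t)⟫_ℂ +
        ⟪b n, (-(Complex.I * (k * ξ t : ℝ))) •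
            V (der b (f t) + (Complex.I * (k * Y t : ℝ)) • V₁ (f t)) +
          ((-(Complex.I * (k * κ * Y t : ℝ))) • V₁ (f t) +
            (-(Complex.I * (ν * k * Y t : ℝ))) • V₂ (der b (f t)))⟫_ℂ) t := by
  have hξ' : ContinuousOn (fun τ => (-(Complex.I * (k * ξ τ : ℝ)))) (Icc 0 T) :=
    (continuousOn_const.mul (Complex.continuous_ofReal.comp_continuousOn
      (continuousOn_const.mul hξ))).neg
  have hh : ContinuousOn (fun τ => (-(Complex.I * (k * ξ τ : ℝ))) • V (f τ)) (Icc 0 T) :=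
    hξ'.smul (V.continuous.comp_continuousOn hf)
  have hD : ∀ τ ∈ Ioo 0 T, HasDer b (f τ) (der b (f τ)) := fun τ hτ =>
    hasDer_of_heat hν hf hh hmode ⟨hτ.1, hτ.2.le⟩
  -- By symmetry of `V₁`, the n-th coefficient of `V₁ f` is `f` tested against `V₁ (b n)`. This
  -- vector has one derivative, which is all the weak form requires.
  have h1 := hasDerivAt_inner_of_heat hν hf hh hmode (hV.prod₁ (hasDer_basis (b := b) n)) ht
  have h2 := (hmode n t ht).const_mul (Complex.I * n)
  have hYc : HasDerivAt (fun τ => Complex.I * (k * Y τ : ℝ))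
      (Complex.I * (k * (ξ t - κ * Y t) : ℝ)) t := (hY.const_mul k).ofReal_comp.const_mul _
  have h3 := h2.add (hYc.mul h1)
  refine (h3.congr_of_eventuallyEq ?_).congr_deriv ?_
  · filter_upwards [Ioo_mem_nhds ht.1 ht.2] with τ hτ
    rw [inner_add_right, inner_smul_right, hD τ hτ n, ← hV.symm₁]
    rfl
  · have e1 := hD t ht n
    have e2 := hV.prod (hD t ht) n
    have e3 := hV.prod₁ (hD t ht) n
    simp only [inner_add_right, inner_smul_right, inner_add_left, inner_smul_left, map_add,
      map_smul, hV.symm₁, hV.symm₂, hV.comm] at *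
    rw [e1]
    simp only [map_mul, Complex.conj_I, map_intCast]
    push_cast
    linear_combination (Complex.I * ν * k * Y t * (Complex.I * n)) * e3 +
      (Complex.I * k * ξ t) * e2 +
      (Complex.I * ν * k * Y t * n ^ 2 * ⟪b n, V₁ (f t)⟫_ℂ) * Complex.I_sq

set_option maxHeartbeats 1000000 in
/-- The pointwise coercivity estimate behind the hypocoercive functional. -/
theorem dissipation_le {ν κ m y K c₀ c₁ A x p q z : ℝ} (hν : 0 < ν) (hκ : 0 < κ) (hm : 0 < m)
    (hy : 0 ≤ y) (hA : κ ^ 2 = A * (ν * m)) (hK : 0 < K) (hc₀ : 0 < c₀)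
    (hA4 : 4 ≤ A) (hA8 : 8 * K ≤ A) (hA12 : 12 * K ^ 2 ≤ A * c₀) (hc₁1 : c₁ ≤ 1)
    (hc₁6 : 6 * c₁ ≤ c₀) (hκy : κ * y ≤ 1) (hp : 0 ≤ p) (hq : 0 ≤ q)
    (hz : m ^ 2 * y ^ 2 * z ^ 2 ≤ 2 * q ^ 2 + 2 * p ^ 2)
    (hgap : c₀ * (κ / m) * x ^ 2 ≤ (κ / m) ^ 2 * p ^ 2 + z ^ 2) :
    -(2 * ν) * p ^ 2 + (ν / κ) * (ν * m ^ 2 * y ^ 2 * K ^ 2 * x ^ 2 / 2 - κ * q ^ 2 + κ * p ^ 2 +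
      2 * (ν * m * y * K * q * p)) ≤
      -(c₁ * ν * κ * m * y ^ 2 * (x ^ 2 + ν / κ * q ^ 2)) := by
  have hA0 : 0 < A := by linarith
  set S := p ^ 2 + q ^ 2 with hS
  have hS0 : 0 ≤ S := by positivity
  set W := κ * m * y ^ 2 * x ^ 2 with hW
  have hW0 : 0 ≤ W := by positivity
  -- The spectral gap at scale ε = κ/m, multiplied by m²y²; the factor κy ≤ 1 keeps its derivative
  -- term bounded by p².
  have hWS : c₀ * W ≤ 3 * S := by
    have h1 := mul_le_mul_of_nonneg_left hgap (show 0 ≤ m ^ 2 * y ^ 2 by positivity)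
    have h2 : m ^ 2 * y ^ 2 * (c₀ * (κ / m) * x ^ 2) = c₀ * W := by
      rw [hW]; field_simp
    have h3 : m ^ 2 * y ^ 2 * ((κ / m) ^ 2 * p ^ 2 + z ^ 2) =
        (κ * y) ^ 2 * p ^ 2 + m ^ 2 * y ^ 2 * z ^ 2 := by field_simp
    have h4 : (κ * y) ^ 2 * p ^ 2 ≤ 1 * p ^ 2 :=
      mul_le_mul_of_nonneg_right (pow_le_one₀ (by positivity) hκy) (sq_nonneg p)
    rw [h2, h3] at h1
    nlinarith [sq_nonneg q]
  -- This ratio puts a factor 1/A in front of the commutator terms, which a large `A` makes small.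
  have hratio : ν * m / κ = κ / A := by
    rw [div_eq_div_iff hκ.ne' hA0.ne']; linarith
  have e1 : (ν / κ) * (ν * m ^ 2 * y ^ 2 * K ^ 2 * x ^ 2 / 2) = ν * (K ^ 2 * W / A) / 2 := by
    have : (ν / κ) * (ν * m ^ 2 * y ^ 2 * K ^ 2 * x ^ 2 / 2) =
        (ν * m / κ) * (ν * m * y ^ 2 * K ^ 2 * x ^ 2 / 2) := by ring
    rw [this, hratio, hW]; ring
  have b1 : K ^ 2 * W / A ≤ S / 4 := by
    rw [div_le_iff₀ hA0]
    have h1 : 12 * K ^ 2 * W ≤ A * c₀ * W := mul_le_mul_of_nonneg_right hA12 hW0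
    have h2 : A * (c₀ * W) ≤ A * (3 * S) := mul_le_mul_of_nonneg_left hWS hA0.le
    linarith
  have e2 : (ν / κ) * (2 * (ν * m * y * K * q * p)) = ν * ((κ * y) * (K / A) * (2 * q * p)) := by
    have : (ν / κ) * (2 * (ν * m * y * K * q * p)) =
        ν * ((ν * m / κ) * y * K * (2 * q * p)) := by ring
    rw [this, hratio]; ring
  have b2 : (κ * y) * (K / A) * (2 * q * p) ≤ S / 8 := by
    have h1 : K / A ≤ 1 / 8 := by rw [div_le_iff₀ hA0]; linarith
    have h2 : (κ * y) * (K / A) ≤ 1 * (1 / 8) :=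
      mul_le_mul hκy h1 (by positivity) zero_le_one
    have h3 : 2 * q * p ≤ S := by nlinarith [sq_nonneg (p - q)]
    calc _ ≤ 1 * (1 / 8) * S := mul_le_mul h2 h3 (by positivity) (by positivity)
      _ = _ := by ring
  have e3 : (ν / κ) * (-κ * q ^ 2 + κ * p ^ 2) = ν * (p ^ 2 - q ^ 2) := by
    field_simp; ring
  have e4 : c₁ * ν * κ * m * y ^ 2 * (x ^ 2 + ν / κ * q ^ 2) =
      ν * (c₁ * W) + ν * (c₁ * ((κ * y) ^ 2 / A) * q ^ 2) := by
    have : c₁ * ν * κ * m * y ^ 2 * (x ^ 2 + ν / κ * q ^ 2) =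
      ν * (c₁ * W) + ν * (c₁ * (κ * y ^ 2 * (ν * m / κ)) * q ^ 2) := by rw [hW]; ring
    rw [this, hratio]; ring
  have b4 : c₁ * W ≤ S / 2 := by
    have : 6 * c₁ * W ≤ c₀ * W := mul_le_mul_of_nonneg_right hc₁6 hW0
    linarith
  have b5 : c₁ * ((κ * y) ^ 2 / A) * q ^ 2 ≤ S / 4 := by
    have h1 : (κ * y) ^ 2 / A ≤ 1 / 4 := by
      rw [div_le_iff₀ hA0]
      have := pow_le_one₀ (n := 2) (by positivity) hκy
      linarith
    have h2 : c₁ * ((κ * y) ^ 2 / A) ≤ 1 * (1 / 4) := mul_le_mul hc₁1 h1 (by positivity) zero_le_one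
    calc _ ≤ 1 * (1 / 4) * q ^ 2 := mul_le_mul_of_nonneg_right h2 (sq_nonneg q)
      _ ≤ _ := by rw [hS]; nlinarith [sq_nonneg p]
  have total : -(2 * ν) * p ^ 2 + (ν / κ) * (ν * m ^ 2 * y ^ 2 * K ^ 2 * x ^ 2 / 2 - κ * q ^ 2 +
      κ * p ^ 2 + 2 * (ν * m * y * K * q * p)) = ν * (-S + K ^ 2 * W / A / 2 +
        (κ * y) * (K / A) * (2 * q * p)) := by
    have : -(2 * ν) * p ^ 2 + (ν / κ) * (ν * m ^ 2 * y ^ 2 * K ^ 2 * x ^ 2 / 2 - κ * q ^ 2 +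
      κ * p ^ 2 + 2 * (ν * m * y * K * q * p)) = -(2 * ν) * p ^ 2 +
      (ν / κ) * (ν * m ^ 2 * y ^ 2 * K ^ 2 * x ^ 2 / 2) +
      (ν / κ) * (-κ * q ^ 2 + κ * p ^ 2) + (ν / κ) * (2 * (ν * m * y * K * q * p)) := by ring
    rw [this, e1, e2, e3, hS]; ring
  -- Budget in units of νS: the two errors cost 1/8 each and the two target terms 1/2 and 1/4, which
  -- exactly exhausts the available 1.
  rw [total, e4, ← mul_add, ← mul_neg]
  exact mul_le_mul_of_nonneg_left (by linarith) hν.le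

/-- Transport by `V` is skew and drops out, while the relaxation term of `Y` equals −κ(g − d).
Young's inequality then leaves half of the damping of `g`; the weight ν/κ later turns κ‖d‖² into
half of the heat dissipation. -/
theorem two_mul_re_inner_source_le (hV : IsShear b V V₁ V₂ K c₀) (hν : 0 < ν) (hκ : 0 < κ)
    {x y : ℝ} (hy : 0 ≤ y) (u d : H) :
    2 * (⟪d + (Complex.I * (k * y : ℝ)) • V₁ u,
      (-(Complex.I * (k * x : ℝ))) • V (d + (Complex.I * (k * y : ℝ)) • V₁ u) +
          ((-(Complex.I * (k * κ * y : ℝ))) • V₁ u + (-(Complex.I * (ν * k * y : ℝ))) • V₂ d)⟫_ℂ).re ≤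
      -κ * ‖d + (Complex.I * (k * y : ℝ)) • V₁ u‖ ^ 2 + κ * ‖d‖ ^ 2 +
        2 * (ν * |k| * y * K * ‖d + (Complex.I * (k * y : ℝ)) • V₁ u‖ * ‖d‖) := by
  set g := d + (Complex.I * (k * y : ℝ)) • V₁ u with hg
  have h1 : (-(Complex.I * (k * κ * y : ℝ))) • V₁ u = (-(κ : ℂ)) • (g - d) := by
    rw [hg, add_sub_cancel_left, smul_smul]
    congr 1; push_cast; ring
  have h2 : (⟪g, (-(κ : ℂ)) • (g - d)⟫_ℂ).re = -κ * (‖g‖ ^ 2 - (⟪g, d⟫_ℂ).re) := by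
    have h3 : (⟪g, g⟫_ℂ).re = ‖g‖ ^ 2 := inner_self_eq_norm_sq (𝕜 := ℂ) g
    rw [inner_smul_right, ← Complex.ofReal_neg, Complex.re_ofReal_mul, inner_sub_right,
      Complex.sub_re, h3]
  have h4 : (⟪g, d⟫_ℂ).re ≤ ‖g‖ * ‖d‖ := re_inner_le_norm (𝕜 := ℂ) g d
  have h5 : (⟪g, (-(Complex.I * (ν * k * y : ℝ))) • V₂ d⟫_ℂ).re ≤
      ν * |k| * y * K * ‖g‖ * ‖d‖ := by
    refine (re_inner_le_norm (𝕜 := ℂ) _ _).trans ?_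
    rw [norm_smul, norm_neg, norm_mul, Complex.norm_I, one_mul, Complex.norm_real,
      Real.norm_eq_abs, abs_mul, abs_mul, abs_of_pos hν, abs_of_nonneg hy]
    calc ‖g‖ * (ν * |k| * y * ‖V₂ d‖) ≤ ‖g‖ * (ν * |k| * y * (K * ‖d‖)) := by
          gcongr; exact hV.bound₂ d
      _ = _ := by ring
  rw [inner_add_right, inner_add_right, Complex.add_re, Complex.add_re,
    re_inner_I_smul_symm hV.symm, h1, h2]
  nlinarith [sq_nonneg (‖g‖ - ‖d‖)]

/-- Adds the energy identity for `f` to ν/κ times the energy inequality for g; `dissipation_le`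
bounds the integrand pointwise in time. It is stated in integral form because g is not known to be
differentiable in time. -/
theorem IsShear.lyapunov (hV : IsShear b V V₁ V₂ K c₀) {A c₁ : ℝ} (hν : 0 < ν) (hκ : 0 < κ)
    (hk : k ≠ 0) (hA : κ ^ 2 = A * (ν * |k|)) (hκk : κ ≤ |k|) (hK : 0 < K) (hc₀ : 0 < c₀)
    (hA4 : 4 ≤ A) (hA8 : 8 * K ≤ A) (hA12 : 12 * K ^ 2 ≤ A * c₀) (hc₁1 : c₁ ≤ 1)
    (hc₁6 : 6 * c₁ ≤ c₀) (hξ : ContinuousOn ξ (Icc 0 T)) (hf : ContinuousOn f (Icc 0 T))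
    (hmode : ∀ n : ℤ, ∀ τ ∈ Ioo 0 T, HasDerivAt (fun τ => ⟪b n, f τ⟫_ℂ)
      (-((ν * n ^ 2 : ℝ) : ℂ) * ⟪b n, f τ⟫_ℂ + ⟪b n, (-(Complex.I * (k * ξ τ : ℝ))) • V (f τ)⟫_ℂ) τ)
    {Y : ℝ → ℝ} (hYc : Continuous Y) {s t : ℝ} (hs : 0 < s) (hst : s ≤ t) (ht : t ≤ T)
    (hY : ∀ τ ∈ Ioo s t, HasDerivAt Y (ξ τ - κ * Y τ) τ)
    (hY0 : ∀ τ ∈ Icc s t, 0 ≤ Y τ ∧ κ * Y τ ≤ 1) :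
    (‖f t‖ ^ 2 + ν / κ * ‖der b (f t) + (Complex.I * (k * Y t : ℝ)) • V₁ (f t)‖ ^ 2) -
      (‖f s‖ ^ 2 + ν / κ * ‖der b (f s) + (Complex.I * (k * Y s : ℝ)) • V₁ (f s)‖ ^ 2) ≤
    -∫ τ in s..t, c₁ * ν * κ * |k| * Y τ ^ 2 * (‖f τ‖ ^ 2 +
      ν / κ * ‖der b (f τ) + (Complex.I * (k * Y τ : ℝ)) • V₁ (f τ)‖ ^ 2) := by
  have hsub : Icc s t ⊆ Icc 0 T := Icc_subset_Icc hs.le ht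
  have hcoef : ∀ φ : ℝ → ℝ, ContinuousOn φ (Icc 0 T) →
      ContinuousOn (fun τ => (-(Complex.I * (φ τ : ℝ)))) (Icc 0 T) := fun φ hφ =>
    (continuousOn_const.mul (Complex.continuous_ofReal.comp_continuousOn hφ)).neg
  have hkξ := hcoef _ (continuousOn_const.mul hξ (f := fun _ => k))
  have hh : ContinuousOn (fun τ => (-(Complex.I * (k * ξ τ : ℝ))) • V (f τ)) (Icc 0 T) :=
    hkξ.smul (V.continuous.comp_continuousOn hf)
  have hf' : ContinuousOn f (Icc s t) := hf.mono hsub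
  have hd : ContinuousOn (fun τ => der b (f τ)) (Icc s t) :=
    (continuousOn_der_of_heat hν hf hh hmode hs).mono (Icc_subset_Icc_right ht)
  have hg : ContinuousOn (fun τ => der b (f τ) + (Complex.I * (k * Y τ : ℝ)) • V₁ (f τ))
      (Icc s t) := hd.add (ContinuousOn.smul (Continuous.continuousOn (by fun_prop))
        (V₁.continuous.comp_continuousOn hf'))
  have hF : ContinuousOn (fun τ => (-(Complex.I * (ν * k * Y τ : ℝ))) • V₂ (f τ)) (Icc s t) :=
    ContinuousOn.smul (Continuous.continuousOn (by fun_prop)) (V₂.continuous.comp_continuousOn hf')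
  have hG : ContinuousOn (fun τ => (-(Complex.I * (k * ξ τ : ℝ))) •
            V (der b (f τ) + (Complex.I * (k * Y τ : ℝ)) • V₁ (f τ)) +
          ((-(Complex.I * (k * κ * Y τ : ℝ))) • V₁ (f τ) +
            (-(Complex.I * (ν * k * Y τ : ℝ))) • V₂ (der b (f τ)))) (Icc s t) :=
    ((hkξ.mono hsub).smul (V.continuous.comp_continuousOn hg)).add
      ((ContinuousOn.smul (Continuous.continuousOn (by fun_prop))
        (V₁.continuous.comp_continuousOn hf')).add
      (ContinuousOn.smul (Continuous.continuousOn (by fun_prop))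
        (V₂.continuous.comp_continuousOn hd)))
  have E1 := integral_sq_norm_der hν hf hh hmode hs hst ht
  simp only [re_inner_I_smul_symm hV.symm, intervalIntegral.integral_zero, mul_zero,
    add_zero] at E1
  have E2 := sq_norm_sub_le (b := b) hν hst hg hF hG (fun n τ hτ =>
    hV.hasDerivAt_mode hν hξ hf hmode ⟨hs.trans hτ.1, hτ.2.trans_le ht⟩ (hY τ hτ) n)
  have hu : uIcc s t = Icc s t := uIcc_of_le hst
  rw [← hu] at hg hF hG hd hf'
  have c1 := (hd.norm.pow 2)
  have c2 := (hF.norm.pow 2)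
  have c3 := Complex.continuous_re.comp_continuousOn (hg.inner (𝕜 := ℂ) hG)
  have c4 := (hg.norm.pow 2)
  have c5 := (hf'.norm.pow 2)
  have E3 : -(2 * ν) * (∫ τ in s..t, ‖der b (f τ)‖ ^ 2) + ν / κ * ((2 * ν)⁻¹ *
      (∫ τ in s..t, ‖(-(Complex.I * (ν * k * Y τ : ℝ))) • V₂ (f τ)‖ ^ 2) +
      2 * ∫ τ in s..t, (⟪der b (f τ) + (Complex.I * (k * Y τ : ℝ)) • V₁ (f τ),
        (-(Complex.I * (k * ξ τ : ℝ))) •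
            V (der b (f τ) + (Complex.I * (k * Y τ : ℝ)) • V₁ (f τ)) +
          ((-(Complex.I * (k * κ * Y τ : ℝ))) • V₁ (f τ) +
            (-(Complex.I * (ν * k * Y τ : ℝ))) • V₂ (der b (f τ)))⟫_ℂ).re) ≤
      ∫ τ in s..t, -(c₁ * ν * κ * |k| * Y τ ^ 2 * (‖f τ‖ ^ 2 +
      ν / κ * ‖der b (f τ) + (Complex.I * (k * Y τ : ℝ)) • V₁ (f τ)‖ ^ 2)) := by
    rw [← intervalIntegral.integral_const_mul, ← intervalIntegral.integral_const_mul,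
      ← intervalIntegral.integral_const_mul, ← intervalIntegral.integral_add,
      ← intervalIntegral.integral_const_mul, ← intervalIntegral.integral_add]
    · refine intervalIntegral.integral_mono_on hst (ContinuousOn.intervalIntegrable ?_)
        (ContinuousOn.intervalIntegrable ?_) fun τ hτ => ?_
      · exact (continuousOn_const.mul c1).add (continuousOn_const.mul
          ((continuousOn_const.mul c2).add (continuousOn_const.mul c3)))
      · exact (ContinuousOn.mul (Continuous.continuousOn (by fun_prop))
          (c5.add (continuousOn_const.mul c4))).neg
      · have hτT : τ ∈ Ioc 0 T := ⟨hs.trans_le hτ.1, hτ.2.trans ht⟩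
        have hD := hasDer_of_heat hν hf hh hmode hτT
        have hm : 0 < |k| := abs_pos.2 hk
        obtain ⟨hy0, hy1⟩ := hY0 τ hτ
        have P2 := two_mul_re_inner_source_le (k := k) hV hν hκ (x := ξ τ) hy0 (f τ) (der b (f τ))
        have P3 : ‖(-(Complex.I * (ν * k * Y τ : ℝ))) • V₂ (f τ)‖ ^ 2 ≤
            ν ^ 2 * |k| ^ 2 * Y τ ^ 2 * K ^ 2 * ‖f τ‖ ^ 2 := by
          rw [norm_smul, norm_neg, norm_mul, Complex.norm_I, one_mul, Complex.norm_real,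
            Real.norm_eq_abs, abs_mul, abs_mul, abs_of_pos hν, abs_of_nonneg hy0]
          calc (ν * |k| * Y τ * ‖V₂ (f τ)‖) ^ 2 ≤ (ν * |k| * Y τ * (K * ‖f τ‖)) ^ 2 := by
                gcongr; exact hV.bound₂ _
            _ = _ := by ring
        set g := der b (f τ) + (Complex.I * (k * Y τ : ℝ)) • V₁ (f τ) with hgdef
        have P4 : |k| ^ 2 * Y τ ^ 2 * ‖V₁ (f τ)‖ ^ 2 ≤ 2 * ‖g‖ ^ 2 + 2 * ‖der b (f τ)‖ ^ 2 := by
          have h1 : ‖(Complex.I * (k * Y τ : ℝ)) • V₁ (f τ)‖ = |k| * Y τ * ‖V₁ (f τ)‖ := by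
            rw [norm_smul, norm_mul, Complex.norm_I, one_mul, Complex.norm_real,
              Real.norm_eq_abs, abs_mul, abs_of_nonneg hy0]
          have h2 : (Complex.I * (k * Y τ : ℝ)) • V₁ (f τ) = g - der b (f τ) := by
            rw [hgdef, add_sub_cancel_left]
          have h3 : |k| * Y τ * ‖V₁ (f τ)‖ ≤ ‖g‖ + ‖der b (f τ)‖ := by
            rw [← h1, h2]; exact norm_sub_le _ _
          have h4 : 0 ≤ |k| * Y τ * ‖V₁ (f τ)‖ := by positivity
          calc |k| ^ 2 * Y τ ^ 2 * ‖V₁ (f τ)‖ ^ 2 = (|k| * Y τ * ‖V₁ (f τ)‖) ^ 2 := by ring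
            _ ≤ (‖g‖ + ‖der b (f τ)‖) ^ 2 := pow_le_pow_left₀ h4 h3 2
            _ ≤ _ := by nlinarith [sq_nonneg (‖g‖ - ‖der b (f τ)‖)]
        -- The scale κ/|k| is of order (ν/|k|)^{1/2}; the assumption κ ≤ |k| makes it admissible.
        have P5 := hV.gap hD (κ / |k|) (by positivity) ((div_le_one hm).2 hκk)
        refine le_trans ?_ (dissipation_le hν hκ hm hy0 hA hK hc₀ hA4 hA8 hA12 hc₁1 hc₁6 hy1
          (norm_nonneg _) (norm_nonneg _) P4 P5)
        have P6 : (2 * ν)⁻¹ * ‖(-(Complex.I * (ν * k * Y τ : ℝ))) • V₂ (f τ)‖ ^ 2 ≤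
            ν * |k| ^ 2 * Y τ ^ 2 * K ^ 2 * ‖f τ‖ ^ 2 / 2 := by
          rw [inv_mul_le_iff₀ (by positivity)]
          linarith
        have P7 : 0 ≤ ν / κ := by positivity
        refine add_le_add_right (mul_le_mul_of_nonneg_left ?_ P7) _
        linarith
    · exact (continuousOn_const.mul c1).intervalIntegrable
    · exact (continuousOn_const.mul
          ((continuousOn_const.mul c2).add (continuousOn_const.mul c3))).intervalIntegrable
    · exact (continuousOn_const.mul c2).intervalIntegrable
    · exact (continuousOn_const.mul c3).intervalIntegrable
  rw [intervalIntegral.integral_neg] at E3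
  have E4 := mul_le_mul_of_nonneg_left E2 (show 0 ≤ ν / κ by positivity)
  rw [mul_sub] at E4
  linarith

theorem IsShear.sq_norm_le (hV : IsShear b V V₁ V₂ K c₀) (hν : 0 < ν)
    (hξ : ContinuousOn ξ (Icc 0 T)) (hf : ContinuousOn f (Icc 0 T))
    (hmode : ∀ n : ℤ, ∀ τ ∈ Ioo 0 T, HasDerivAt (fun τ => ⟪b n, f τ⟫_ℂ)
      (-((ν * n ^ 2 : ℝ) : ℂ) * ⟪b n, f τ⟫_ℂ + ⟪b n, (-(Complex.I * (k * ξ τ : ℝ))) • V (f τ)⟫_ℂ) τ)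
    {t : ℝ} (ht : t ∈ Icc 0 T) : ‖f t‖ ^ 2 ≤ ‖f 0‖ ^ 2 := by
  have hsub : Icc 0 t ⊆ Icc 0 T := Icc_subset_Icc_right ht.2
  have hh : ContinuousOn (fun τ => (-(Complex.I * (k * ξ τ : ℝ))) • V (f τ)) (Icc 0 T) :=
    ((continuousOn_const.mul (Complex.continuous_ofReal.comp_continuousOn
      (continuousOn_const.mul hξ))).neg).smul (V.continuous.comp_continuousOn hf)
  have h1 := sq_norm_sub_le (b := b) (F := fun _ => 0) hν ht.1 (hf.mono hsub)
    continuousOn_const (hh.mono hsub)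
    (fun n τ hτ => by simpa using hmode n τ ⟨hτ.1, hτ.2.trans_le ht.2⟩)
  simp only [re_inner_I_smul_symm hV.symm, norm_zero, ne_eq, OfNat.ofNat_ne_zero,
    not_false_eq_true, zero_pow, intervalIntegral.integral_zero, mul_zero, add_zero] at h1
  linarith

theorem exists_mul_le_integral {p : ℝ → ℝ} {a c : ℝ} (hac : a ≤ c) (hp : ContinuousOn p (Icc a c)) :
    ∃ t ∈ Icc a c, (c - a) * p t ≤ ∫ τ in a..c, p τ := by
  obtain ⟨t, ht, hmin⟩ := isCompact_Icc.exists_isMinOn (nonempty_Icc.2 hac) hp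
  refine ⟨t, ht, ?_⟩
  rw [← smul_eq_mul, ← intervalIntegral.integral_const]
  refine intervalIntegral.integral_mono_on hac (continuous_const.intervalIntegrable _ _)
    (ContinuousOn.intervalIntegrable (by rwa [uIcc_of_le hac])) fun τ hτ => hmin hτ

/-- Up to time 1/κ the exponent is at most 1, so monotonicity of the energy suffices at the price of
e ≤ 3. Later times use the functional started at a well-chosen t₁ ≤ 1/κ. -/
theorem IsShear.decay (hV : IsShear b V V₁ V₂ K c₀) {A c₁ : ℝ} (hν : 0 < ν) (hκ : 0 < κ)
    (hk : k ≠ 0) (hA : κ ^ 2 = A * (ν * |k|)) (hκk : κ ≤ |k|) (hK : 0 < K) (hc₀ : 0 < c₀)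
    (hA4 : 4 ≤ A) (hA8 : 8 * K ≤ A) (hA12 : 12 * K ^ 2 ≤ A * c₀) (hc₁ : 0 < c₁) (hc₁1 : c₁ ≤ 1)
    (hc₁6 : 6 * c₁ ≤ c₀) (hξ : ContinuousOn ξ (Icc 0 T)) (hf : ContinuousOn f (Icc 0 T))
    (h01 : ∀ t ∈ Icc 0 T, 0 ≤ ξ t ∧ ξ t ≤ 1)
    (hlip : ∀ s t, 0 ≤ s → s ≤ t → t ≤ T → ξ t - ξ s ≤ κ / 2 * (t - s))
    (hmode : ∀ n : ℤ, ∀ τ ∈ Ioo 0 T, HasDerivAt (fun τ => ⟪b n, f τ⟫_ℂ)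
      (-((ν * n ^ 2 : ℝ) : ℂ) * ⟪b n, f τ⟫_ℂ + ⟪b n, (-(Complex.I * (k * ξ τ : ℝ))) • V (f τ)⟫_ℂ) τ)
    {t : ℝ} (ht : t ∈ Icc 0 T) :
    ‖f t‖ ^ 2 ≤ 3 * (3 + 2 * K ^ 2 * (ν * |k| ^ 2 / κ ^ 3)) *
      exp (-(c₁ * (ν * |k| / κ) / 6 * ∫ τ in (0 : ℝ)..t, ξ τ ^ 3)) * ‖f 0‖ ^ 2 := by
  have hm : 0 < |k| := abs_pos.2 hk
  set ρ := c₁ * (ν * |k| / κ) / 6 with hρ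
  have hρ0 : 0 < ρ := by positivity
  have hρκ : ρ / κ ≤ 1 := by
    have h1 : ν * |k| / κ = κ / A := by
      rw [div_eq_div_iff hκ.ne' (by linarith)]; linarith
    have h2 : ρ / κ = c₁ / (6 * A) := by
      rw [hρ, h1]
      have : A ≠ 0 := by linarith
      field_simp
    rw [h2, div_le_one (by linarith)]
    linarith
  have hξ3 : ContinuousOn (fun τ => ξ τ ^ 3) (Icc 0 T) := hξ.pow 3
  have hint : ∀ a c, 0 ≤ a → a ≤ c → c ≤ T →
      IntervalIntegrable (fun τ => ξ τ ^ 3) volume a c := fun a c ha hac hc =>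
    ContinuousOn.intervalIntegrable (hξ3.mono (by
      rw [uIcc_of_le hac]; exact Icc_subset_Icc ha hc))
  have hint_le : ∀ c, 0 ≤ c → c ≤ T → c ≤ 1 / κ → ρ * ∫ τ in (0 : ℝ)..c, ξ τ ^ 3 ≤ 1 := by
    intro c hc0 hcT hcκ
    have h1 : ∫ τ in (0 : ℝ)..c, ξ τ ^ 3 ≤ ∫ _τ in (0 : ℝ)..c, (1 : ℝ) :=
      intervalIntegral.integral_mono_on hc0 (hint 0 c le_rfl hc0 hcT)
        (continuous_const.intervalIntegrable _ _) fun τ hτ =>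
        pow_le_one₀ (h01 τ ⟨hτ.1, hτ.2.trans hcT⟩).1 (h01 τ ⟨hτ.1, hτ.2.trans hcT⟩).2
    rw [intervalIntegral.integral_const, smul_eq_mul, mul_one, sub_zero] at h1
    calc ρ * ∫ τ in (0 : ℝ)..c, ξ τ ^ 3 ≤ ρ * (1 / κ) :=
          mul_le_mul_of_nonneg_left (h1.trans hcκ) hρ0.le
      _ ≤ 1 := by rw [mul_one_div]; exact hρκ
  have hexp1 : exp 1 ≤ 3 := exp_one_lt_d9.le.trans (by norm_num)
  have hE0 : 0 ≤ ‖f 0‖ ^ 2 := by positivity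
  have hB0 : 0 ≤ 2 * K ^ 2 * (ν * |k| ^ 2 / κ ^ 3) := by positivity
  rcases le_or_gt t (1 / κ) with htκ | htκ
  · have h1 := hV.sq_norm_le hν hξ hf hmode ht
    have h2 := hint_le t ht.1 ht.2 htκ
    have h3 : 1 ≤ 3 * exp (-(ρ * ∫ τ in (0 : ℝ)..t, ξ τ ^ 3)) := by
      have h4 : exp (-1) ≤ exp (-(ρ * ∫ τ in (0 : ℝ)..t, ξ τ ^ 3)) := exp_le_exp.2 (by linarith)
      have h5 : exp 1 * exp (-1) = 1 := by rw [← exp_add]; simp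
      nlinarith [exp_pos (-1)]
    have h6 : 1 ≤ 3 * (3 + 2 * K ^ 2 * (ν * |k| ^ 2 / κ ^ 3)) *
        exp (-(ρ * ∫ τ in (0 : ℝ)..t, ξ τ ^ 3)) := by
      nlinarith [exp_pos (-(ρ * ∫ τ in (0 : ℝ)..t, ξ τ ^ 3))]
    calc _ ≤ 1 * ‖f 0‖ ^ 2 := by rw [one_mul]; exact h1
      _ ≤ _ := mul_le_mul_of_nonneg_right h6 hE0
  · have hκi : 0 < 1 / κ := by positivity
    have hh : ContinuousOn (fun τ => (-(Complex.I * (k * ξ τ : ℝ))) • V (f τ)) (Icc 0 T) :=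
      ((continuousOn_const.mul (Complex.continuous_ofReal.comp_continuousOn
        (continuousOn_const.mul hξ))).neg).smul (V.continuous.comp_continuousOn hf)
    have hs0 : 0 < 1 / κ / 2 := by positivity
    have hsκ : 1 / κ / 2 ≤ 1 / κ := by linarith
    have hκT : 1 / κ ≤ T := htκ.le.trans ht.2
    have hd := continuousOn_der_of_heat hν hf hh hmode hs0
    -- The energy identity bounds 2ν∫‖∂f‖² over [1/(2κ), 1/κ] by ‖f(0)‖². At some time of this
    -- interval, of length 1/(2κ), therefore (ν/κ)‖∂f‖² ≤ ‖f(0)‖².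
    obtain ⟨t₁, ht₁, hle⟩ := exists_mul_le_integral hsκ
      ((hd.mono (Icc_subset_Icc_right hκT)).norm.pow 2)
    have ht₁0 : 0 < t₁ := hs0.trans_le ht₁.1
    have ht₁t : t₁ ≤ t := ht₁.2.trans htκ.le
    have ht₁T : t₁ ∈ Icc 0 T := ⟨ht₁0.le, ht₁t.trans ht.2⟩
    have hder : ν / κ * ‖der b (f t₁)‖ ^ 2 ≤ ‖f 0‖ ^ 2 := by
      have E1 := integral_sq_norm_der hν hf hh hmode hs0 hsκ hκT
      simp only [re_inner_I_smul_symm hV.symm, intervalIntegral.integral_zero, mul_zero,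
        add_zero] at E1
      have E2 := hV.sq_norm_le hν hξ hf hmode (t := 1 / κ / 2) ⟨hs0.le, hsκ.trans hκT⟩
      have E3 := sq_nonneg ‖f (1 / κ)‖
      have E4 := mul_le_mul_of_nonneg_left hle (show 0 ≤ 2 * ν by positivity)
      simp only [Pi.pow_apply] at E4
      have E5 : 2 * ν * ((1 / κ - 1 / κ / 2) * ‖der b (f t₁)‖ ^ 2) =
        ν / κ * ‖der b (f t₁)‖ ^ 2 := by ring
      linarith
    obtain ⟨Y, hYc, hYt₁, hYd, hY0, hYint⟩ := exists_memory hκ hξ h01 hlip ht₁T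
    set g : ℝ → H := fun τ => der b (f τ) + (Complex.I * (k * Y τ : ℝ)) • V₁ (f τ) with hg
    have hsub : Icc t₁ t ⊆ Icc 0 T := Icc_subset_Icc ht₁0.le ht.2
    have hgc : ContinuousOn g (Icc t₁ t) :=
      (hd.mono (Icc_subset_Icc ht₁.1 ht.2)).add
        (ContinuousOn.smul (Continuous.continuousOn (by fun_prop))
        (V₁.continuous.comp_continuousOn (hf.mono hsub)))
    have hG := le_mul_exp_of_integral_le (Ψ := fun τ => ‖f τ‖ ^ 2 + ν / κ * ‖g τ‖ ^ 2)
      (r := fun τ => c₁ * ν * κ * |k| * Y τ ^ 2) ht₁t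
      (((hf.mono hsub).norm.pow 2).add (continuousOn_const.mul (hgc.norm.pow 2)))
      (Continuous.continuousOn (by fun_prop)) (fun τ _ => by positivity)
      (fun s hs => hV.lyapunov hν hκ hk hA hκk hK hc₀ hA4 hA8 hA12 hc₁1 hc₁6 hξ hf hmode hYc
        (ht₁0.trans_le hs.1) hs.2 ht.2
        (fun τ hτ => hYd τ ⟨hs.1.trans_lt hτ.1, hτ.2.trans_le ht.2⟩)
        (fun τ hτ => hY0 τ ⟨hs.1.trans hτ.1, hτ.2.trans ht.2⟩))
    -- Because `Y t₁ = 1 / κ`, the corrector contributes νk²/κ³, which is of order (|k|/ν)^{1/2}: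
    -- this is the origin of the prefactor.
    have hΨ₁ : ‖f t₁‖ ^ 2 + ν / κ * ‖g t₁‖ ^ 2 ≤
        (3 + 2 * K ^ 2 * (ν * |k| ^ 2 / κ ^ 3)) * ‖f 0‖ ^ 2 := by
      have h1 := hV.sq_norm_le hν hξ hf hmode ht₁T
      have h2 : ‖g t₁‖ ≤ ‖der b (f t₁)‖ + |k| * (1 / κ) * (K * ‖f t₁‖) := by
        refine (norm_add_le _ _).trans (add_le_add_right ?_ _)
        rw [norm_smul, norm_mul, Complex.norm_I, one_mul, Complex.norm_real,
              Real.norm_eq_abs, abs_mul, hYt₁, abs_of_pos hκi]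
        exact mul_le_mul_of_nonneg_left (hV.bound₁ _) (by positivity)
      have h3 : ‖g t₁‖ ^ 2 ≤ 2 * ‖der b (f t₁)‖ ^ 2 + 2 * (|k| * (1 / κ) * (K * ‖f t₁‖)) ^ 2 := by
        have := pow_le_pow_left₀ (norm_nonneg _) h2 2
        nlinarith [sq_nonneg (‖der b (f t₁)‖ - |k| * (1 / κ) * (K * ‖f t₁‖))]
      have h4 := mul_le_mul_of_nonneg_left h3 (show 0 ≤ ν / κ by positivity)
      have h5 : ν / κ * (2 * (|k| * (1 / κ) * (K * ‖f t₁‖)) ^ 2) =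
          2 * K ^ 2 * (ν * |k| ^ 2 / κ ^ 3) * ‖f t₁‖ ^ 2 := by field_simp
      have h6 := mul_le_mul_of_nonneg_left h1 hB0
      linarith
    have hexp : exp (-∫ τ in t₁..t, c₁ * ν * κ * |k| * Y τ ^ 2) ≤
        3 * exp (-(ρ * ∫ τ in (0 : ℝ)..t, ξ τ ^ 3)) := by
      have h1 := hYint t ⟨ht₁t, ht.2⟩
      have h2 := intervalIntegral.integral_add_adjacent_intervals
        (hint 0 t₁ le_rfl ht₁0.le ht₁T.2) (hint t₁ t ht₁0.le ht₁t ht.2)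
      have h3 := hint_le t₁ ht₁0.le ht₁T.2 ht₁.2
      have h4 : ρ * ∫ τ in t₁..t, ξ τ ^ 3 ≤ ∫ τ in t₁..t, c₁ * ν * κ * |k| * Y τ ^ 2 := by
        rw [intervalIntegral.integral_const_mul]
        refine (mul_le_mul_of_nonneg_left h1 hρ0.le).trans_eq ?_
        rw [hρ]; field_simp
      have h5 : exp (-∫ τ in t₁..t, c₁ * ν * κ * |k| * Y τ ^ 2) ≤
          exp (1 + -(ρ * ∫ τ in (0 : ℝ)..t, ξ τ ^ 3)) := by
        refine exp_le_exp.2 ?_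
        rw [← h2, mul_add]
        linarith
      rw [exp_add] at h5
      exact h5.trans (mul_le_mul_of_nonneg_right hexp1 (exp_pos _).le)
    calc ‖f t‖ ^ 2 ≤ ‖f t‖ ^ 2 + ν / κ * ‖g t‖ ^ 2 := le_add_of_nonneg_right (by positivity)
      _ ≤ _ := hG
      _ ≤ ((3 + 2 * K ^ 2 * (ν * |k| ^ 2 / κ ^ 3)) * ‖f 0‖ ^ 2) *
          (3 * exp (-(ρ * ∫ τ in (0 : ℝ)..t, ξ τ ^ 3))) :=
        mul_le_mul hΨ₁ hexp (exp_pos _).le (by positivity)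
      _ = _ := by ring

end Hypocoercivity

/-! ### Multiplication operators and Fourier series on the circle. -/

section Circle

theorem mulOp_bound (w : C(Circ, ℝ)) (f : L2Circ) (y : Circ) :
    ‖(w y : ℂ) * f y‖ ≤ ‖w‖ * ‖f y‖ := by
  rw [norm_mul, Complex.norm_real]
  exact mul_le_mul_of_nonneg_right (w.norm_coe_le_norm y) (norm_nonneg _)

theorem memLp_mul (w : C(Circ, ℝ)) (f : L2Circ) :
    MemLp (fun y => (w y : ℂ) * f y) 2 (AddCircle.haarAddCircle : Measure Circ) :=
  MemLp.of_le_mul (c := ‖w‖) (Lp.memLp f)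
    ((Complex.continuous_ofReal.comp w.continuous).aestronglyMeasurable.mul
      (Lp.memLp f).aestronglyMeasurable)
    (Filter.Eventually.of_forall fun y => mulOp_bound w f y)

/-- Multiplication by a continuous real function, as an operator on `L²(𝕋)`. -/
noncomputable def mulOp (w : C(Circ, ℝ)) : L2Circ →L[ℂ] L2Circ :=
  LinearMap.mkContinuous
    { toFun := fun f => (memLp_mul w f).toLp _
      map_add' := fun f g => by
        rw [← MemLp.toLp_add (memLp_mul w f) (memLp_mul w g), MemLp.toLp_eq_toLp_iff]
        filter_upwards [Lp.coeFn_add f g] with y hy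
        simp only [Pi.add_apply, hy]
        ring
      map_smul' := fun c f => by
        rw [RingHom.id_apply, ← MemLp.toLp_const_smul c (memLp_mul w f), MemLp.toLp_eq_toLp_iff]
        filter_upwards [Lp.coeFn_smul c f] with y hy
        simp only [Pi.smul_apply, hy, smul_eq_mul]
        ring }
    ‖w‖ fun f => Lp.norm_le_mul_norm_of_ae_le_mul (by
      filter_upwards [(memLp_mul w f).coeFn_toLp] with y hy
      simp only [LinearMap.coe_mk, AddHom.coe_mk, hy]
      exact mulOp_bound w f y)

theorem coeFn_mulOp (w : C(Circ, ℝ)) (f : L2Circ) :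
    mulOp w f =ᵐ[AddCircle.haarAddCircle] fun y => (w y : ℂ) * f y :=
  (memLp_mul w f).coeFn_toLp

theorem norm_mulOp_le (w : C(Circ, ℝ)) (f : L2Circ) : ‖mulOp w f‖ ≤ ‖w‖ * ‖f‖ :=
  Lp.norm_le_mul_norm_of_ae_le_mul (by
    filter_upwards [coeFn_mulOp w f] with y hy
    rw [hy]
    exact mulOp_bound w f y)

theorem inner_mulOp (w : C(Circ, ℝ)) (f g : L2Circ) :
    ⟪mulOp w f, g⟫_ℂ = ⟪f, mulOp w g⟫_ℂ := by
  rw [L2.inner_def, L2.inner_def]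
  refine integral_congr_ae ?_
  filter_upwards [coeFn_mulOp w f, coeFn_mulOp w g] with y h1 h2
  rw [h1, h2, RCLike.inner_apply, RCLike.inner_apply, map_mul, Complex.conj_ofReal]
  ring

theorem mulOp_mul (w₁ w₂ : C(Circ, ℝ)) (f : L2Circ) :
    mulOp (w₁ * w₂) f = mulOp w₁ (mulOp w₂ f) := by
  refine Lp.ext ?_
  filter_upwards [coeFn_mulOp (w₁ * w₂) f, coeFn_mulOp w₁ (mulOp w₂ f), coeFn_mulOp w₂ f]
    with y h1 h2 h3
  rw [h1, h2, h3, ContinuousMap.mul_apply]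
  push_cast
  ring

theorem mulOp_add (w₁ w₂ : C(Circ, ℝ)) (f : L2Circ) :
    mulOp (w₁ + w₂) f = mulOp w₁ f + mulOp w₂ f := by
  refine Lp.ext ?_
  filter_upwards [coeFn_mulOp (w₁ + w₂) f, coeFn_mulOp w₁ f, coeFn_mulOp w₂ f,
    Lp.coeFn_add (mulOp w₁ f) (mulOp w₂ f)] with y h1 h2 h3 h4
  rw [h1, h4, Pi.add_apply, h2, h3, ContinuousMap.add_apply]
  push_cast
  ring

theorem le_re_inner_mulOp {w : C(Circ, ℝ)} {c : ℝ} (hc : ∀ y, c ≤ w y) (f : L2Circ) :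
    c * ‖f‖ ^ 2 ≤ (⟪f, mulOp w f⟫_ℂ).re := by
  have h1 : c * ‖f‖ ^ 2 = (⟪f, (c : ℂ) • f⟫_ℂ).re := by
    have h2 : (⟪f, f⟫_ℂ).re = ‖f‖ ^ 2 := inner_self_eq_norm_sq (𝕜 := ℂ) f
    rw [inner_smul_right, Complex.re_ofReal_mul, h2]
  have key : ∀ g h : L2Circ, (⟪g, h⟫_ℂ).re =
      ∫ y, (⟪g y, h y⟫_ℂ).re ∂AddCircle.haarAddCircle := fun g h => by
    rw [L2.inner_def]
    exact (integral_re (L2.integrable_inner (𝕜 := ℂ) g h)).symm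
  rw [h1, key, key]
  refine integral_mono_ae (L2.integrable_inner (𝕜 := ℂ) f _).re
    (L2.integrable_inner (𝕜 := ℂ) f _).re ?_
  filter_upwards [coeFn_mulOp w f, Lp.coeFn_smul (c : ℂ) f] with y h2 h3
  have h4 : ∀ r : ℝ, (r * f y * conj (f y)).re = r * ‖f y‖ ^ 2 := fun r => by
    rw [mul_assoc, Complex.re_ofReal_mul, Complex.mul_conj, Complex.ofReal_re,
      Complex.normSq_eq_norm_sq]
  rw [h2, h3, RCLike.inner_apply, RCLike.inner_apply, Pi.smul_apply, smul_eq_mul, h4, h4]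
  exact mul_le_mul_of_nonneg_right (hc y) (sq_nonneg _)

theorem inner_fourierBasis (f : L2Circ) (n : ℤ) :
    ⟪fourierBasis n, f⟫_ℂ = fourierCoeff f n := by
  rw [← fourierBasis.repr_apply_apply, fourierBasis_repr]

theorem hasDerivAt_fourier_circ (n : ℤ) (x : ℝ) :
    HasDerivAt (fun y : ℝ => fourier n (y : Circ)) (Complex.I * n * fourier n (x : Circ)) x := by
  refine (hasDerivAt_fourier (2 * π) n x).congr_deriv ?_
  have : (π : ℂ) ≠ 0 := Complex.ofReal_ne_zero.2 pi_ne_zero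
  push_cast
  field_simp

theorem fourierCoeff_of_hasDerivAt {u u' : Circ → ℂ} (hu : Continuous u) (hu' : Continuous u')
    (h : ∀ x : ℝ, HasDerivAt (fun y : ℝ => u y) (u' x) x) (n : ℤ) :
    fourierCoeff u' n = Complex.I * n * fourierCoeff u n := by
  have hc : Continuous fun x : ℝ => (x : Circ) := AddCircle.continuous_mk' _
  have hE : ∀ n : ℤ, Continuous fun x : ℝ => fourier n (x : Circ) := fun n =>
    (fourier n).continuous.comp hc
  have hiu : IntervalIntegrable (fun x : ℝ => Complex.I * ((-n : ℤ) : ℂ) * fourier (-n) (x : Circ) *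
      u x) volume 0 (0 + 2 * π) :=
    Continuous.intervalIntegrable ((continuous_const.mul (hE (-n))).mul (hu.comp hc)) _ _
  have hiu' : IntervalIntegrable (fun x : ℝ => fourier (-n) (x : Circ) * u' x) volume 0
      (0 + 2 * π) := Continuous.intervalIntegrable ((hE (-n)).mul (hu'.comp hc)) _ _
  have h1 : ∫ x in (0 : ℝ)..0 + 2 * π, (Complex.I * ((-n : ℤ) : ℂ) * fourier (-n) (x : Circ) * u x +
      fourier (-n) (x : Circ) * u' x) = fourier (-n) ((0 + 2 * π : ℝ) : Circ) * u (0 + 2 * π : ℝ) -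
        fourier (-n) ((0 : ℝ) : Circ) * u (0 : ℝ) :=
    intervalIntegral.integral_eq_sub_of_hasDerivAt
      (fun x _ => (hasDerivAt_fourier_circ (-n) x).mul (h x))
      (hiu.add hiu')
  have hper : ((0 + 2 * π : ℝ) : Circ) = ((0 : ℝ) : Circ) := AddCircle.coe_add_period _ _
  rw [hper, sub_self, intervalIntegral.integral_add hiu hiu'] at h1
  simp only [mul_assoc (Complex.I * ((-n : ℤ) : ℂ))] at h1
  rw [intervalIntegral.integral_const_mul] at h1
  rw [fourierCoeff_eq_intervalIntegral u' n 0, fourierCoeff_eq_intervalIntegral u n 0]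
  simp only [smul_eq_mul, Complex.real_smul]
  push_cast at h1
  linear_combination (((1 / (2 * π) : ℝ) : ℂ)) * h1

/-- `w'` is the derivative of `w`. -/
def IsDerivPair (w w' : C(Circ, ℝ)) : Prop :=
  ∀ x : ℝ, HasDerivAt (fun y : ℝ => w y) (w' x) x

theorem inner_fourierBasis_mulOp (w : C(Circ, ℝ)) (n m : ℤ) :
    ⟪fourierBasis m, mulOp w (fourierBasis n)⟫_ℂ =
      fourierCoeff (fun y => (w y : ℂ) * fourier n y) m := by
  rw [inner_fourierBasis]
  refine congr_fun (fourierCoeff_congr_ae ?_) m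
  filter_upwards [coeFn_mulOp w (fourierBasis n), coeFn_fourierLp (T := 2 * π) 2 n] with y h1 h2
  rw [h1, coe_fourierBasis, h2]

theorem hasDer_mulOp_basis {w w' : C(Circ, ℝ)} (hw : IsDerivPair w w') (n : ℤ) :
    HasDer fourierBasis (mulOp w (fourierBasis n))
      (mulOp w' (fourierBasis n) + mulOp w ((Complex.I * n) • fourierBasis n)) := by
  intro m
  have hc : ∀ w : C(Circ, ℝ), Continuous fun y => (w y : ℂ) * fourier n y := fun w =>
    (Complex.continuous_ofReal.comp w.continuous).mul (fourier n).continuous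
  rw [map_smul, inner_add_right, inner_smul_right, inner_fourierBasis_mulOp,
    inner_fourierBasis_mulOp, ← fourierCoeff_of_hasDerivAt (hc w)
      ((hc w').add ((hc w).const_smul (Complex.I * n)))
      (fun x => ((hw x).ofReal_comp.mul (hasDerivAt_fourier_circ n x)).congr_deriv (by
        simp only [Pi.add_apply, Pi.smul_apply, smul_eq_mul]; ring)) m]
  have hi : ∀ w : C(Circ, ℝ), Integrable (fun y => (w y : ℂ) * fourier n y)
      AddCircle.haarAddCircle := fun w => (hc w).integrable_of_hasCompactSupport
        (HasCompactSupport.of_compactSpace _)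
  rw [fourierCoeff.add (hi w') ((hi w).smul _)]
  simp only [Pi.add_apply, fourierCoeff.const_smul, smul_eq_mul]

/-- Product rule by duality: the multiplier is moved onto the basis vector, where the classical
product rule holds, and integration by parts is applied there. No approximation of `f` is needed. -/
theorem hasDer_mulOp {w w' : C(Circ, ℝ)} (hw : IsDerivPair w w') {f h : L2Circ}
    (hf : HasDer fourierBasis f h) :
    HasDer fourierBasis (mulOp w f) (mulOp w' f + mulOp w h) := by
  intro n
  have h1 := hf.integration_by_parts (hasDer_mulOp_basis hw n)
  rw [map_smul, inner_add_left, inner_smul_left] at h1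
  rw [inner_add_right, ← inner_mulOp, ← inner_mulOp, ← inner_mulOp]
  simp only [map_mul, Complex.conj_I, map_intCast] at h1
  linear_combination h1

theorem continuous_of_lift {E : Type*} [TopologicalSpace E] {f : Circ → E}
    (h : Continuous fun y : ℝ => f (y : Circ)) : Continuous f :=
  isQuotientMap_quotient_mk'.continuous_iff.2 h

theorem dy_coe {E : Type*} [NormedAddCommGroup E] [NormedSpace ℝ E] (f : Circ → E) (x : ℝ) :
    dy f (x : Circ) = deriv (fun y : ℝ => f (y : Circ)) x := by
  have := deriv_comp_const_add (fun y : ℝ => f (y : Circ)) x 0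
  rw [add_zero] at this
  rw [← this]
  rfl

theorem IsCn.dy {E : Type*} [NormedAddCommGroup E] [NormedSpace ℝ E] {n : WithTop ℕ∞}
    {f : Circ → E} (h : IsCn (n + 1) f) : IsCn n (dy f) := by
  have h1 : ContDiff ℝ n (deriv fun y : ℝ => f (y : Circ)) := (contDiff_succ_iff_deriv.1 h).2.2
  rw [IsCn]
  simpa only [dy_coe] using h1

theorem IsCn.hasDerivAt {E : Type*} [NormedAddCommGroup E] [NormedSpace ℝ E] {f : Circ → E}
    (h : IsCn 1 f) (x : ℝ) : HasDerivAt (fun y : ℝ => f (y : Circ)) (ShearFlow.dy f (x : Circ)) x := by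
  rw [dy_coe]
  exact (h.differentiable one_ne_zero x).hasDerivAt

/-! ### The spectral gap inequality at simple zeros. -/

theorem IsDerivPair.mul {w w' u u' : C(Circ, ℝ)} (hw : IsDerivPair w w') (hu : IsDerivPair u u') :
    IsDerivPair (w * u) (w' * u + w * u') := fun x => (hw x).mul (hu x)

/-- The natural choice s = w' need not be differentiable. A difference quotient of `w` is as smooth
as `w`, and for a small step it has the sign of `w'` at each of the finitely many zeros. -/
theorem IsDerivPair.exists_sign_multiplier {w w' : C(Circ, ℝ)} (hw : IsDerivPair w w')
    (hfin : {y | w y = 0}.Finite) (hne : ∀ y, w y = 0 → w' y ≠ 0) :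
    ∃ s s' : C(Circ, ℝ), IsDerivPair s s' ∧ ∀ y, w y = 0 → 0 < s y * w' y := by
  have hev : ∀ y ∈ {y | w y = 0}, ∀ᶠ h : ℝ in nhdsWithin 0 {0}ᶜ,
      0 < h⁻¹ * (w (y + (h : Circ)) - w y) * w' y := by
    intro y hy
    obtain ⟨x, rfl⟩ := QuotientAddGroup.mk_surjective y
    have h1 := (hasDerivAt_iff_tendsto_slope_zero.1 (hw x)).mul_const (w' x)
    have h2 : 0 < w' x * w' x := mul_self_pos.2 (hne _ hy)
    filter_upwards [h1.eventually (lt_mem_nhds h2)] with h hh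
    exact hh
  obtain ⟨h, hh⟩ := ((Filter.eventually_all_finite hfin).2 hev).exists
  have hs : ∀ u : C(Circ, ℝ), Continuous fun y => h⁻¹ * (u (y + (h : Circ)) - u y) := fun u => by
    fun_prop
  refine ⟨⟨_, hs w⟩, ⟨_, hs w'⟩, fun x => ?_, fun y hy => hh y hy⟩
  have h1 : HasDerivAt (fun y : ℝ => w ((y + h : ℝ) : Circ)) (w' ((x + h : ℝ) : Circ)) x :=
    (hw (x + h)).comp_add_const x h
  exact (h1.sub (hw x)).const_mul h⁻¹

/-- Compactness: the open sets where P + n w² is positive increase with `n` and cover the circle. -/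
theorem exists_pos_lower_bound {P w : C(Circ, ℝ)} (h : ∀ y, w y = 0 → 0 < P y) :
    ∃ (M : ℕ) (c : ℝ), 0 < c ∧ ∀ y, c ≤ P y + M * w y ^ 2 := by
  obtain ⟨M, hM⟩ := isCompact_univ.elim_directed_cover
    (fun n : ℕ => {y : Circ | 0 < P y + n * w y ^ 2})
    (fun n => isOpen_lt continuous_const (by fun_prop)) (fun y _ => by
      by_cases hy : w y = 0
      · exact mem_iUnion.2 ⟨0, by simpa using h y hy⟩
      · have hw : 0 < w y ^ 2 := by positivity
        obtain ⟨n, hn⟩ := exists_nat_gt (|P y| / w y ^ 2)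
        refine mem_iUnion.2 ⟨n, ?_⟩
        rw [div_lt_iff₀ hw] at hn
        rw [mem_ofPred_eq]
        linarith [neg_abs_le (P y)])
    (directed_of_isDirected_le fun m n hmn y (hy : 0 < P y + m * w y ^ 2) => by
      have : (m : ℝ) * w y ^ 2 ≤ n * w y ^ 2 := by gcongr
      exact hy.trans_le (by linarith))
  obtain ⟨y₀, -, hy₀⟩ := isCompact_univ.exists_isMinOn (univ_nonempty (α := Circ))
    (f := fun y => P y + M * w y ^ 2) (Continuous.continuousOn (by fun_prop))
  exact ⟨M, _, hM (mem_univ y₀), fun y => hy₀ (mem_univ y)⟩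

/-- The derivative (sw)' is positive at the zeros of `w`, hence (sw)' + M w² ≥ c > 0 everywhere.
Integrating (sw)'|f|² by parts bounds it by 2‖s‖‖wf‖‖∂f‖, and Young's inequality with weight ε
concludes. -/
theorem IsDerivPair.exists_spectral_gap {w w' : C(Circ, ℝ)} (hw : IsDerivPair w w')
    (hfin : {y | w y = 0}.Finite) (hne : ∀ y, w y = 0 → w' y ≠ 0) :
    ∃ c₀ : ℝ, 0 < c₀ ∧ ∀ {f h : L2Circ}, HasDer fourierBasis f h → ∀ ε : ℝ, 0 < ε → ε ≤ 1 →
      c₀ * ε * ‖f‖ ^ 2 ≤ ε ^ 2 * ‖h‖ ^ 2 + ‖mulOp w f‖ ^ 2 := by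
  obtain ⟨s, s', hs, hpos⟩ := hw.exists_sign_multiplier hfin hne
  obtain ⟨M, c, hc, hle⟩ := exists_pos_lower_bound (P := s' * w + s * w') (w := w) fun y hy => by
    simpa [hy] using hpos y hy
  -- Young's inequality costs ‖s‖ and the term M w² costs `M`, where ε ≤ 1 is used; the 1 keeps the
  -- denominator positive.
  refine ⟨c / (‖s‖ + M + 1), by positivity, fun {f h} hf ε hε hε1 => ?_⟩
  have h1 : c * ‖f‖ ^ 2 ≤ (⟪f, mulOp (s' * w + s * w') f⟫_ℂ).re + M * ‖mulOp w f‖ ^ 2 := by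
    have h2 := le_re_inner_mulOp (w := s' * w + s * w' + (M : ℝ) • (w * w)) (c := c)
      (fun y => by
        refine (hle y).trans_eq ?_
        simp [pow_two]) f
    refine h2.trans_eq ?_
    have h3 : mulOp ((M : ℝ) • (w * w)) f = ((M : ℝ) : ℂ) • mulOp w (mulOp w f) := by
      rw [← mulOp_mul]
      refine Lp.ext ?_
      filter_upwards [coeFn_mulOp ((M : ℝ) • (w * w)) f, coeFn_mulOp (w * w) f,
        Lp.coeFn_smul ((M : ℝ) : ℂ) (mulOp (w * w) f)] with y e1 e2 e3
      rw [e1, e3, Pi.smul_apply, e2, ContinuousMap.smul_apply]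
      push_cast [smul_eq_mul]
      ring
    have h4 : (⟪mulOp w f, mulOp w f⟫_ℂ).re = ‖mulOp w f‖ ^ 2 :=
      inner_self_eq_norm_sq (𝕜 := ℂ) _
    rw [mulOp_add, inner_add_right, Complex.add_re, h3, inner_smul_right, Complex.re_ofReal_mul,
      ← inner_mulOp w f, h4]
  have h2 := congr_arg Complex.re (hf.integration_by_parts (hasDer_mulOp (hs.mul hw) hf))
  rw [inner_add_left, Complex.add_re, Complex.neg_re, inner_mulOp (s * w) h f, inner_mulOp _ f f]
    at h2
  have h3 : (⟪f, mulOp (s' * w + s * w') f⟫_ℂ).re ≤ 2 * (‖s‖ * ‖mulOp w f‖ * ‖h‖) := by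
    have e0 : ‖mulOp (s * w) f‖ ≤ ‖s‖ * ‖mulOp w f‖ := by rw [mulOp_mul]; exact norm_mulOp_le _ _
    have e1 : |(⟪h, mulOp (s * w) f⟫_ℂ).re| ≤ ‖s‖ * ‖mulOp w f‖ * ‖h‖ :=
      (Complex.abs_re_le_norm _).trans ((norm_inner_le_norm _ _).trans (by
        rw [mul_comm]; exact mul_le_mul_of_nonneg_right e0 (norm_nonneg _)))
    have e2 : |(⟪mulOp (s * w) f, h⟫_ℂ).re| ≤ ‖s‖ * ‖mulOp w f‖ * ‖h‖ :=
      (Complex.abs_re_le_norm _).trans ((norm_inner_le_norm _ _).trans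
        (mul_le_mul_of_nonneg_right e0 (norm_nonneg _)))
    linarith [neg_abs_le (⟪h, mulOp (s * w) f⟫_ℂ).re, neg_abs_le (⟪mulOp (s * w) f, h⟫_ℂ).re]
  set z := ‖mulOp w f‖
  set p := ‖h‖
  have hM0 : (0 : ℝ) ≤ M := Nat.cast_nonneg M
  rw [div_mul_eq_mul_div, div_mul_eq_mul_div, div_le_iff₀ (by positivity)]
  have h4 : c * ε * ‖f‖ ^ 2 ≤ ε * (2 * (‖s‖ * z * p) + M * z ^ 2) := by
    have := mul_le_mul_of_nonneg_left (h1.trans (add_le_add_left h3 _)) hε.le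
    linarith
  have h5 : ε * (M * z ^ 2) ≤ 1 * (M * z ^ 2) := mul_le_mul_of_nonneg_right hε1 (by positivity)
  have h6 : 0 ≤ ‖s‖ * (ε * p - z) ^ 2 := by positivity
  have h7 : 0 ≤ (M : ℝ) * (ε ^ 2 * p ^ 2) := by positivity
  nlinarith [sq_nonneg (ε * p), sq_nonneg z]

theorem exists_isShear {v v₁ v₂ : C(Circ, ℝ)} (h₁ : IsDerivPair v v₁) (h₂ : IsDerivPair v₁ v₂)
    (hfin : {y | v₁ y = 0}.Finite) (hne : ∀ y, v₁ y = 0 → v₂ y ≠ 0) :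
    ∃ K c₀ : ℝ, 0 < K ∧ 0 < c₀ ∧
      IsShear fourierBasis (mulOp v) (mulOp v₁) (mulOp v₂) K c₀ := by
  obtain ⟨c₀, hc₀, hgap⟩ := h₂.exists_spectral_gap hfin hne
  refine ⟨‖v₁‖ + ‖v₂‖ + 1, c₀, by positivity, hc₀, inner_mulOp v, inner_mulOp v₁, inner_mulOp v₂,
    fun x => ?_, hasDer_mulOp h₁, hasDer_mulOp h₂, fun x => ?_, fun x => ?_, hgap⟩
  · rw [← mulOp_mul, ← mulOp_mul, mul_comm v₁ v]
  · exact (norm_mulOp_le _ _).trans (mul_le_mul_of_nonneg_right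
      (by linarith [norm_nonneg v₂]) (norm_nonneg x))
  · exact (norm_mulOp_le _ _).trans (mul_le_mul_of_nonneg_right
      (by linarith [norm_nonneg v₁]) (norm_nonneg x))

/-! ### From the weak formulation to equations for the Fourier modes. -/

theorem dy_fourier (n : ℤ) (c : ℂ) :
    dy (fun y : Circ => c * fourier n y) = fun y => Complex.I * n * c * fourier n y := by
  funext y
  obtain ⟨x, rfl⟩ := QuotientAddGroup.mk_surjective y
  refine (dy_coe _ x).trans ?_
  rw [((hasDerivAt_fourier_circ n x).const_mul c).deriv]
  ring_nf

theorem isCn_fourier (n : ℤ) : IsCn ∞ (fun y : Circ => fourier n y) := by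
  rw [IsCn]
  simp only [fourier_coe_apply]
  have : ContDiff ℝ ∞ fun y : ℝ => (y : ℂ) := Complex.ofRealCLM.contDiff
  exact ((contDiff_const.mul this).div_const _).cexp

theorem integral_mul_fourier (f : L2Circ) (n : ℤ) :
    ∫ y, f y * fourier (-n) y ∂AddCircle.haarAddCircle = ⟪fourierBasis n, f⟫_ℂ := by
  rw [inner_fourierBasis, fourierCoeff]
  simp only [smul_eq_mul, mul_comm]

/-- The weak pairing is bilinear, so the n-th coefficient is obtained with the test function of
frequency −n. The time integrand is then continuous, so the integrated equation holds classically
inside the interval. -/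
theorem IsWeakSolution.hasDerivAt_mode {ν : ℝ} {k : ℤ} {ξ : ℝ → ℝ} {v : C(Circ, ℝ)} {T : ℝ}
    {Θ₀ : L2Circ} {Θ : ℝ → L2Circ} (h : IsWeakSolution ν k ξ v T Θ₀ Θ)
    (hξ : ContinuousOn ξ (Icc 0 T)) (n : ℤ) {t : ℝ} (ht : t ∈ Ioo 0 T) :
    HasDerivAt (fun τ => ⟪fourierBasis n, Θ τ⟫_ℂ)
      (-((ν * k ^ 2 + ν * n ^ 2 : ℝ) : ℂ) * ⟪fourierBasis n, Θ t⟫_ℂ +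
        ⟪fourierBasis n, (-(Complex.I * (k * ξ t : ℝ))) • mulOp v (Θ t)⟫_ℂ) t := by
  have hdd : dy (dy fun y : Circ => fourier (-n) y) = fun y => -(n : ℂ) ^ 2 * fourier (-n) y := by
    have h1 := dy_fourier (-n) 1
    simp only [one_mul, mul_one] at h1
    rw [h1, dy_fourier]
    funext y
    push_cast
    linear_combination ((n : ℂ) ^ 2 * fourier (-n) y) * Complex.I_sq
  have hinner : ∀ s, ∫ y, Θ s y * ((ν : ℂ) * (-(k : ℂ) ^ 2 * fourier (-n) y +
      dy (dy fun y : Circ => fourier (-n) y) y) -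
        Complex.I * (k : ℂ) * (ξ s : ℂ) * (v y : ℂ) * fourier (-n) y) ∂AddCircle.haarAddCircle =
      -((ν * k ^ 2 + ν * n ^ 2 : ℝ) : ℂ) * ⟪fourierBasis n, Θ s⟫_ℂ +
        ⟪fourierBasis n, (-(Complex.I * (k * ξ s : ℝ))) • mulOp v (Θ s)⟫_ℂ := by
    intro s
    rw [← inner_smul_right, ← inner_add_right, ← integral_mul_fourier]
    refine integral_congr_ae ?_
    filter_upwards [Lp.coeFn_add ((-((ν * k ^ 2 + ν * n ^ 2 : ℝ) : ℂ)) • Θ s)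
      ((-(Complex.I * (k * ξ s : ℝ))) • mulOp v (Θ s)),
      Lp.coeFn_smul (-((ν * k ^ 2 + ν * n ^ 2 : ℝ) : ℂ)) (Θ s),
      Lp.coeFn_smul (-(Complex.I * (k * ξ s : ℝ))) (mulOp v (Θ s)),
      coeFn_mulOp v (Θ s)] with y e1 e2 e3 e4
    rw [e1, Pi.add_apply, e2, e3, Pi.smul_apply, Pi.smul_apply, e4, hdd]
    simp only [smul_eq_mul]
    push_cast
    ring
  have hcont : ContinuousOn (fun s => -((ν * k ^ 2 + ν * n ^ 2 : ℝ) : ℂ) *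
      ⟪fourierBasis n, Θ s⟫_ℂ +
        ⟪fourierBasis n, (-(Complex.I * (k * ξ s : ℝ))) • mulOp v (Θ s)⟫_ℂ) (Icc 0 T) :=
    (continuousOn_const.mul (continuousOn_const.inner h.continuousOn)).add
      (continuousOn_const.inner ((continuousOn_const.mul
        (Complex.continuous_ofReal.comp_continuousOn (continuousOn_const.mul hξ))).neg.smul
        ((mulOp v).continuous.comp_continuousOn h.continuousOn)))
  have hint : ∀ r ∈ Icc 0 T, ⟪fourierBasis n, Θ r⟫_ℂ = ⟪fourierBasis n, Θ₀⟫_ℂ +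
      ∫ s in (0 : ℝ)..r, (-((ν * k ^ 2 + ν * n ^ 2 : ℝ) : ℂ) * ⟪fourierBasis n, Θ s⟫_ℂ +
        ⟪fourierBasis n, (-(Complex.I * (k * ξ s : ℝ))) • mulOp v (Θ s)⟫_ℂ) := by
    intro r hr
    have := h.weak _ (isCn_fourier (-n)) r hr
    rw [integral_mul_fourier, integral_mul_fourier] at this
    simpa only [hinner] using this
  have hmem : Icc 0 T ∈ nhds t := Icc_mem_nhds ht.1 ht.2
  have hd := intervalIntegral.integral_hasDerivAt_right (a := 0) (b := t)
    (ContinuousOn.intervalIntegrable (hcont.mono (by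
      rw [uIcc_of_le ht.1.le]; exact Icc_subset_Icc_right ht.2.le)))
    (hcont.stronglyMeasurableAtFilter_nhdsWithin measurableSet_Icc t |>.filter_mono (by
      rw [nhdsWithin_eq_nhds.2 hmem]))
    (hcont.continuousAt hmem)
  refine (hd.const_add ⟪fourierBasis n, Θ₀⟫_ℂ).congr_of_eventuallyEq ?_
  filter_upwards [hmem] with r hr
  exact hint r hr

/-- The integrating factor removes the zeroth-order damping νk²; it returns at the end as the sharp
factor exp(−2νk²t). -/
theorem IsWeakSolution.hasDerivAt_mode_exp {ν : ℝ} {k : ℤ} {ξ : ℝ → ℝ} {v : C(Circ, ℝ)} {T : ℝ}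
    {Θ₀ : L2Circ} {Θ : ℝ → L2Circ} (h : IsWeakSolution ν k ξ v T Θ₀ Θ)
    (hξ : ContinuousOn ξ (Icc 0 T)) (n : ℤ) {t : ℝ} (ht : t ∈ Ioo 0 T) :
    HasDerivAt (fun τ => ⟪fourierBasis n, (exp (ν * k ^ 2 * τ) : ℂ) • Θ τ⟫_ℂ)
      (-((ν * n ^ 2 : ℝ) : ℂ) * ⟪fourierBasis n, (exp (ν * k ^ 2 * t) : ℂ) • Θ t⟫_ℂ +
        ⟪fourierBasis n, (-(Complex.I * (k * ξ t : ℝ))) •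
          mulOp v ((exp (ν * k ^ 2 * t) : ℂ) • Θ t)⟫_ℂ) t := by
  have h1 : HasDerivAt (fun τ : ℝ => ((exp (ν * k ^ 2 * τ) : ℝ) : ℂ))
      ((exp (ν * k ^ 2 * t) * (ν * k ^ 2) : ℝ) : ℂ) t := by
    have := ((hasDerivAt_id t).const_mul (ν * (k : ℝ) ^ 2)).exp.ofReal_comp
    simpa using this
  have h2 := h1.mul (h.hasDerivAt_mode hξ n ht)
  simp only [inner_smul_right, map_smul] at h2 ⊢
  refine h2.congr_deriv ?_
  push_cast
  ring

end Circle

/-! ### The one-sided slope bound and the choice of constants. -/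

theorem sub_le_of_ae_deriv_le {ξ : ℝ → ℝ} {T L : ℝ} (hT : 0 < T)
    (hξ : AbsolutelyContinuousOnInterval ξ 0 T)
    (hL : ∀ᵐ t ∂(volume.restrict (Icc 0 T)), deriv ξ t ≤ L) {s t : ℝ} (hs : 0 ≤ s) (hst : s ≤ t)
    (ht : t ≤ T) : ξ t - ξ s ≤ L * (t - s) := by
  have hac : AbsolutelyContinuousOnInterval ξ s t := hξ.mono (by
    rw [uIcc_of_le hst, uIcc_of_le hT.le]; exact Icc_subset_Icc hs ht)
  rw [← hac.integral_deriv_eq_sub]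
  have h1 : ∫ τ in s..t, deriv ξ τ ≤ ∫ _τ in s..t, L :=
    intervalIntegral.integral_mono_ae_restrict hst hac.intervalIntegrable_deriv
      (continuous_const.intervalIntegrable _ _)
      (ae_restrict_of_ae_restrict_of_subset (Icc_subset_Icc hs ht) hL)
  rw [intervalIntegral.integral_const, smul_eq_mul, mul_comm] at h1
  exact h1

end ShearFlow

theorem theorem2 (v : ShearFlow.Circ → ℝ) (hv : ShearFlow.IsCn 2 v)
    (hcrit : ShearFlow.HasSimpleCriticalPoints v) :
    ∃ ν₀ Cξ C' Ced : ℝ, 0 < ν₀ ∧ 0 < Cξ ∧ 0 < C' ∧ 0 < Ced ∧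
      ∀ (ν : ℝ) (k : ℤ), 0 < ν → ν ≤ ν₀ → k ≠ 0 →
        ν / |(k : ℝ)| ≤ C' ∧
        ∀ (T : ℝ) (ξ : ℝ → ℝ) (Θ₀ : ShearFlow.L2Circ) (Θ : ℝ → ShearFlow.L2Circ),
          0 < T →
          AbsolutelyContinuousOnInterval ξ 0 T →
          (∀ t ∈ Set.Icc 0 T, 0 ≤ ξ t ∧ ξ t ≤ 1) →
          (∀ᵐ t ∂(MeasureTheory.volume.restrict (Set.Icc 0 T)),
            deriv ξ t ≤ Cξ * (ν * |(k : ℝ)|) ^ (1 / 2 : ℝ)) →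
          ShearFlow.IsWeakSolution ν k ξ v T Θ₀ Θ →
          ∀ t ∈ Set.Icc 0 T,
            ‖Θ t‖ ^ 2 ≤ Ced * (1 + (|(k : ℝ)| / ν) ^ (1 / 2 : ℝ)) *
              Real.exp (-C' * (ν * |(k : ℝ)|) ^ (1 / 2 : ℝ) * (∫ τ in (0 : ℝ)..t, ξ τ ^ 3)
                - 2 * ν * (k : ℝ) ^ 2 * t) * ‖Θ₀‖ ^ 2 := by
  open ShearFlow in
  have hv1 : IsCn 1 (dy v) := IsCn.dy (by rwa [one_add_one_eq_two])
  have hv2 : IsCn 0 (dy (dy v)) := IsCn.dy (by rwa [zero_add])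
  have hv0 : IsCn 1 v := ContDiff.of_le hv one_le_two
  obtain ⟨K, c₀, hK, hc₀, hS⟩ := exists_isShear
    (v := ⟨v, continuous_of_lift hv.continuous⟩) (v₁ := ⟨dy v, continuous_of_lift hv1.continuous⟩)
    (v₂ := ⟨dy (dy v), continuous_of_lift hv2.continuous⟩)
    (fun x => hv0.hasDerivAt x) (fun x => hv1.hasDerivAt x) hcrit.1 hcrit.2
  obtain ⟨A, hA4, hA8, hA12⟩ : ∃ A : ℝ, 4 ≤ A ∧ 8 * K ≤ A ∧ 12 * K ^ 2 ≤ A * c₀ := by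
    refine ⟨max (max 4 (8 * K)) (12 * K ^ 2 / c₀), ?_, ?_, ?_⟩
    · exact (le_max_left _ _).trans (le_max_left _ _)
    · exact (le_max_right _ _).trans (le_max_left _ _)
    · rw [← div_le_iff₀ hc₀]; exact le_max_right _ _
  obtain ⟨c₁, hc₁, hc₁1, hc₁6⟩ : ∃ c₁ : ℝ, 0 < c₁ ∧ c₁ ≤ 1 ∧ 6 * c₁ ≤ c₀ :=
    ⟨min 1 (c₀ / 6), by positivity, min_le_left _ _, by linarith [min_le_right 1 (c₀ / 6)]⟩
  have hA0 : 0 < A := by linarith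
  set a := √A with ha
  have ha0 : 0 < a := Real.sqrt_pos.2 hA0
  have haA : a ^ 2 = A := Real.sq_sqrt hA0.le
  -- With κ = a(ν|k|)^{1/2}: ν ≤ 1/A gives κ ≤ |k|, and ν ≤ c₁/(6a) gives ν/|k| ≤ C'. The slope
  -- bound a/2 is κ/2 in these units, and c₁/(6a) comes from the rate c₁(ν|k|/κ)/6. The last
  -- constant majorizes 3(3 + 2K²νk²/κ³).
  refine ⟨min (1 / A) (c₁ / (6 * a)), a / 2, c₁ / (6 * a), 9 + 6 * K ^ 2 / a ^ 3, by positivity,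
    by positivity, by positivity, by positivity, fun ν k hν hν₀ hk => ?_⟩
  have hk1 : 1 ≤ |(k : ℝ)| := by exact_mod_cast Int.one_le_abs hk
  have hm : 0 < |(k : ℝ)| := by linarith
  refine ⟨(div_le_self hν.le hk1).trans (hν₀.trans (min_le_right _ _)), ?_⟩
  intro T ξ Θ₀ Θ hT hξac h01 hξ' hΘ t ht
  rw [← Real.sqrt_eq_rpow] at hξ'
  rw [← Real.sqrt_eq_rpow, ← Real.sqrt_eq_rpow]
  set q := √(ν * |(k : ℝ)|) with hq
  have hq0 : 0 < q := Real.sqrt_pos.2 (by positivity)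
  have hq2 : q ^ 2 = ν * |(k : ℝ)| := Real.sq_sqrt (by positivity)
  have hκ : (a * q) ^ 2 = A * (ν * |(k : ℝ)|) := by rw [mul_pow, haA, hq2]
  have hAν : A * ν ≤ 1 := by
    have h1 := hν₀.trans (min_le_left _ _)
    rwa [le_div_iff₀ hA0, mul_comm] at h1
  have hκk : a * q ≤ |(k : ℝ)| := by
    refine (pow_le_pow_iff_left₀ (by positivity) hm.le two_ne_zero).1 ?_
    rw [hκ]
    nlinarith [mul_le_mul_of_nonneg_right hAν hm.le]
  have hξc : ContinuousOn ξ (Icc 0 T) := by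
    have := hξac.continuousOn
    rwa [uIcc_of_le hT.le] at this
  have hcont : ContinuousOn (fun τ => (Real.exp (ν * (k : ℝ) ^ 2 * τ) : ℂ) • Θ τ) (Icc 0 T) :=
    have hE : Continuous fun τ : ℝ => (Real.exp (ν * (k : ℝ) ^ 2 * τ) : ℂ) := by fun_prop
    hE.continuousOn.smul hΘ.continuousOn
  have key := hS.decay (k := (k : ℝ)) hν (mul_pos ha0 hq0) (by exact_mod_cast hk) hκ hκk hK hc₀
    hA4 hA8 hA12 hc₁ hc₁1 hc₁6 hξc hcont h01
    (fun s r hs hsr hr => (sub_le_of_ae_deriv_le hT hξac hξ' hs hsr hr).trans_eq (by ring))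
    (fun n τ hτ => IsWeakSolution.hasDerivAt_mode_exp
      (v := ⟨v, continuous_of_lift hv.continuous⟩) hΘ hξc n hτ) ht
  have e1 : ν * |(k : ℝ)| / (a * q) = q / a := by
    rw [← hq2]; field_simp
  have e2 : ν * |(k : ℝ)| ^ 2 / (a * q) ^ 3 = √(|(k : ℝ)| / ν) / a ^ 3 := by
    have h1 : √(|(k : ℝ)| / ν) = |(k : ℝ)| / q := by
      rw [Real.sqrt_eq_iff_mul_self_eq (by positivity) (by positivity), div_mul_div_comm, ← pow_two,
        ← pow_two, hq2]
      field_simp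
    rw [h1, show ν * |(k : ℝ)| ^ 2 = (ν * |(k : ℝ)|) * |(k : ℝ)| by ring, ← hq2]
    field_simp
  rw [e1, e2] at key
  set X := √(|(k : ℝ)| / ν)
  have hX : 0 ≤ X := Real.sqrt_nonneg _
  set I := ∫ τ in (0 : ℝ)..t, ξ τ ^ 3
  simp only [mul_zero, Real.exp_zero, Complex.ofReal_one, one_smul, hΘ.initial, norm_smul,
    Complex.norm_real, Real.norm_eq_abs, abs_of_pos (Real.exp_pos _), mul_pow] at key
  have e3 : Real.exp (-(2 * ν * (k : ℝ) ^ 2 * t)) * Real.exp (ν * (k : ℝ) ^ 2 * t) ^ 2 = 1 := by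
    rw [pow_two (Real.exp _), ← Real.exp_add, ← Real.exp_add, ← Real.exp_zero]
    ring_nf
  have e4 : Real.exp (-(c₁ / (6 * a)) * q * I - 2 * ν * (k : ℝ) ^ 2 * t) =
      Real.exp (-(2 * ν * (k : ℝ) ^ 2 * t)) * Real.exp (-(c₁ * (q / a) / 6 * I)) := by
    rw [← Real.exp_add]
    congr 1
    field_simp
    ring
  have e5 : 3 * (3 + 2 * K ^ 2 * (X / a ^ 3)) ≤ (9 + 6 * K ^ 2 / a ^ 3) * (1 + X) := by
    have h1 : 0 ≤ 6 * K ^ 2 / a ^ 3 := by positivity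
    have h2 : 3 * (3 + 2 * K ^ 2 * (X / a ^ 3)) = 9 + 6 * K ^ 2 / a ^ 3 * X := by ring
    rw [h2]
    nlinarith [mul_nonneg h1 hX]
  calc ‖Θ t‖ ^ 2
      = Real.exp (-(2 * ν * (k : ℝ) ^ 2 * t)) *
          (Real.exp (ν * (k : ℝ) ^ 2 * t) ^ 2 * ‖Θ t‖ ^ 2) := by rw [← mul_assoc, e3, one_mul]
    _ ≤ Real.exp (-(2 * ν * (k : ℝ) ^ 2 * t)) * (3 * (3 + 2 * K ^ 2 * (X / a ^ 3)) *
          Real.exp (-(c₁ * (q / a) / 6 * I)) * ‖Θ₀‖ ^ 2) :=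
        mul_le_mul_of_nonneg_left (by simpa using key) (Real.exp_pos _).le
    _ = 3 * (3 + 2 * K ^ 2 * (X / a ^ 3)) *
          Real.exp (-(c₁ / (6 * a)) * q * I - 2 * ν * (k : ℝ) ^ 2 * t) * ‖Θ₀‖ ^ 2 := by
        rw [e4]; ring
    _ ≤ _ := by gcongr
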